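/- Conventions. A dual operator system is a complex linear space $M\subseteq\mathcal B(H)$ of bounded operators on a complex Hilbert space $H$ that contains the identity $\mathbf 1$, satisfies $M^*=M$, and is closed in the weak$^*$ (ultraweak) topology of $\mathcal B(H)$; it carries the relative weak$^*$-topology. Its predual $M_*$ is the space of weak$^*$-continuous linear functionals on $M$, and $M^{\rm sa}$ is the real space of self-adjoint elements of $M$, with the operator norm. A UP map is a weak$^*$-continuous (normal), unit-preserving, positive linear map between dual operator systems. A UP-isomorphism is a bijective UP map whose inverse is a UP map, and a UP-automorphism is a UP-isomorphism of a dual operator system onto itself. Let $\phi:M\to M$ be a UP map. A reversible lift of $\phi$ is a triple $(N,\alpha,E)$ where $N$ is a dual operator system (possibly on another Hilbert space), $\alpha:N\to N$ is a UP-automorphism, and $E:N\to M$ is a UP map with $E\circ\alpha=\phi\circ E$. It is an asymptotic lift if, in addition, (a) (nondegeneracy) for $y\in N$, if $E(\alpha^{-n}(y))=0$ for all $n=0,1,2,\dots$ then $y=0$; (b) $\displaystyle \|\rho\circ E\restriction_{N^{\rm sa}}\|=\lim_{k\to\infty}\|\rho\circ\phi^k\restriction_{M^{\rm sa}}\|$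 for every $\rho\in M_*$. Theorem. Let $\phi:M\to M$ be a UP map on a dual operator system $M\subseteq\mathcal B(H)$. (1) $\phi$ has an asymptotic lift $(N,\alpha,E)$. More precisely, call a sequence $(x_n)_{n\in\mathbb Z}$ in $M$ an inverse sequence if it is bounded and $x_n=\phi(x_{n+1})$ for all $n\in\mathbb Z$, and regard it as the diagonal operator $(\xi_n)\mapsto(x_n\xi_n)$ on $\ell^2(\mathbb Z;H)$. Then the space $N$ of all inverse sequences is a dual operator system on $\ell^2(\mathbb Z;H)$, and together with the bilateral shift $\alpha:(x_n)\mapsto(x_{n-1})$ and the map $E:(x_n)\mapsto x_0$ it is an asymptotic lift of $\phi$. (2) If $(N_1,\alpha_1,E_1)$ and $(N_2,\alpha_2,E_2)$ are two asymptotic lifts of $\phi$, then there is a unique UP-isomorphism $\theta:N_1\to N_2$ such that $\theta\circ\alpha_1=\alpha_2\circ\theta$ and $E_2\circ\theta=E_1$. -/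

import Mathlib

open Filter Topology
open scoped ENNReal

/-- The functional `T ↦ ∑ₙ ⟨ξₙ, T ηₙ⟩` on `B(H)` given by two square-summable sequences `ξ, η` of
vectors of `H`. -/
noncomputable def vectorSeriesFunctional {H : Type*} [NormedAddCommGroup H] [InnerProductSpace ℂ H]
    (ξ η : lp (fun _ : ℕ => H) 2) (T : H →L[ℂ] H) : ℂ :=
  ∑' n : ℕ, inner ℂ (ξ n) (T (η n))

/-- The series defining `vectorSeriesFunctional` always converges absolutely. -/
theorem summable_vectorSeriesFunctional {H : Type*} [NormedAddCommGroup H] [InnerProductSpace ℂ H]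
    (ξ η : lp (fun _ : ℕ => H) 2) (T : H →L[ℂ] H) :
    Summable fun n : ℕ => ‖(inner ℂ (ξ n) (T (η n)) : ℂ)‖ := by
  have hξ := (lp.memℓp ξ).summable (by norm_num)
  have hη := (lp.memℓp η).summable (by norm_num)
  simp only [ENNReal.toReal_ofNat, Real.rpow_two] at hξ hη
  refine Summable.of_nonneg_of_le (fun _ => norm_nonneg _) (fun n => ?_)
    ((hξ.add hη).mul_left ‖T‖)
  have h1 : ‖(inner ℂ (ξ n) (T (η n)) : ℂ)‖ ≤ ‖ξ n‖ * ‖T (η n)‖ := norm_inner_le_norm _ _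
  have h2 : ‖ξ n‖ * ‖T (η n)‖ ≤ ‖ξ n‖ * (‖T‖ * ‖η n‖) := by
    gcongr
    exact T.le_opNorm _
  have h3 : ‖ξ n‖ * ‖η n‖ ≤ ‖ξ n‖ ^ 2 + ‖η n‖ ^ 2 := by
    nlinarith [sq_nonneg (‖ξ n‖ - ‖η n‖), sq_nonneg (‖ξ n‖), sq_nonneg (‖η n‖)]
  have h4 := mul_le_mul_of_nonneg_left h3 (norm_nonneg T)
  linarith

/-- The weak-star (ultraweak, sigma-weak) topology of `B(H)`: the coarsest topology that makes all
functionals `T ↦ ∑ₙ ⟨ξₙ, T ηₙ⟩` with `∑ ‖ξₙ‖² < ∞`, `∑ ‖ηₙ‖² < ∞` continuous. -/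
noncomputable abbrev ultraweakTopology (H : Type*) [NormedAddCommGroup H] [InnerProductSpace ℂ H] :
    TopologicalSpace (H →L[ℂ] H) :=
  ⨅ (ξ : lp (fun _ : ℕ => H) 2) (η : lp (fun _ : ℕ => H) 2),
    TopologicalSpace.induced (vectorSeriesFunctional ξ η) inferInstance

/-- A dual operator system on a complex Hilbert space `H`: a complex linear space of bounded
operators that contains the identity, is self-adjoint, and is weak-star closed in `B(H)`. -/
structure DualOperatorSystem (H : Type*) [NormedAddCommGroup H] [InnerProductSpace ℂ H]
    [CompleteSpace H] extends Submodule ℂ (H →L[ℂ] H) where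
  one_mem' : (1 : H →L[ℂ] H) ∈ carrier
  star_mem' : ∀ T : H →L[ℂ] H, T ∈ carrier → star T ∈ carrier
  isClosed' : IsClosed[ultraweakTopology H] carrier

namespace DualOperatorSystem

variable {H : Type*} [NormedAddCommGroup H] [InnerProductSpace ℂ H] [CompleteSpace H]

instance : CoeSort (DualOperatorSystem H) (Type _) := ⟨fun M => M.toSubmodule⟩

/-- The identity operator, as an element of `M`. -/
def unit (M : DualOperatorSystem H) : M := ⟨1, M.one_mem'⟩

/-- The weak-star topology of `M`, i.e. the relative weak-star topology of `B(H)`. -/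
noncomputable abbrev weakStar (M : DualOperatorSystem H) : TopologicalSpace M :=
  TopologicalSpace.induced (fun x : M => (x : H →L[ℂ] H)) (ultraweakTopology H)

/-- `ρ` belongs to the predual of `M`: it is a weak-star continuous linear functional on `M`. -/
def IsNormalFunctional {M : DualOperatorSystem H} (ρ : M →ₗ[ℂ] ℂ) : Prop :=
  Continuous[M.weakStar, inferInstance] ρ

/-- The norm of the restriction of a linear functional to the self-adjoint part of `M`
(with value `∞` if that restriction is unbounded, which does not happen for normal functionals). -/
noncomputable def saNorm {M : DualOperatorSystem H} (f : M →ₗ[ℂ] ℂ) : ℝ≥0∞ :=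
  ⨆ (x : M) (_ : IsSelfAdjoint (x : H →L[ℂ] H)) (_ : ‖(x : H →L[ℂ] H)‖ ≤ 1), ‖f x‖ₑ

end DualOperatorSystem

/-- A UP map: a normal, unit-preserving, positive linear map of dual operator systems. Positivity
refers to the usual (Loewner) order of operators. -/
structure UPMap {H K : Type*} [NormedAddCommGroup H] [InnerProductSpace ℂ H] [CompleteSpace H]
    [NormedAddCommGroup K] [InnerProductSpace ℂ K] [CompleteSpace K]
    (M : DualOperatorSystem H) (N : DualOperatorSystem K) extends M →ₗ[ℂ] N where
  map_unit' : toFun M.unit = N.unit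
  map_nonneg' : ∀ x : M, 0 ≤ (x : H →L[ℂ] H) → 0 ≤ (toFun x : K →L[ℂ] K)
  normal' : Continuous[M.weakStar, N.weakStar] toFun

/-- A UP-isomorphism: an invertible UP map whose inverse is a UP map. -/
structure UPIso {H K : Type*} [NormedAddCommGroup H] [InnerProductSpace ℂ H] [CompleteSpace H]
    [NormedAddCommGroup K] [InnerProductSpace ℂ K] [CompleteSpace K]
    (M : DualOperatorSystem H) (N : DualOperatorSystem K) extends M ≃ₗ[ℂ] N where
  map_unit' : toFun M.unit = N.unit
  map_nonneg' : ∀ x : M, 0 ≤ (x : H →L[ℂ] H) → 0 ≤ (toFun x : K →L[ℂ] K)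
  inv_nonneg' : ∀ y : N, 0 ≤ (y : K →L[ℂ] K) → 0 ≤ (invFun y : H →L[ℂ] H)
  normal' : Continuous[M.weakStar, N.weakStar] toFun
  inv_normal' : Continuous[N.weakStar, M.weakStar] invFun

section Lifts

variable {H K : Type*} [NormedAddCommGroup H] [InnerProductSpace ℂ H] [CompleteSpace H]
  [NormedAddCommGroup K] [InnerProductSpace ℂ K] [CompleteSpace K]

instance (M : DualOperatorSystem H) (N : DualOperatorSystem K) :
    CoeFun (UPMap M N) (fun _ => M → N) := ⟨fun φ => φ.toLinearMap⟩

instance (M : DualOperatorSystem H) (N : DualOperatorSystem K) :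
    CoeFun (UPIso M N) (fun _ => M → N) := ⟨fun θ => θ.toLinearEquiv⟩

/-- `(N, α, E)` is a reversible lift of `φ : M → M`. -/
def IsReversibleLift {M : DualOperatorSystem H} (φ : UPMap M M) {N : DualOperatorSystem K}
    (α : UPIso N N) (E : UPMap N M) : Prop :=
  ∀ y : N, E (α y) = φ (E y)

/-- Nondegeneracy: if `E (α⁻ⁿ y) = 0` for all `n = 0, 1, 2, …` then `y = 0`. -/
def IsNondegenerateLift {M : DualOperatorSystem H} {N : DualOperatorSystem K}
    (α : UPIso N N) (E : UPMap N M) : Prop :=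
  ∀ y : N, (∀ n : ℕ, E (α.toLinearEquiv.symm^[n] y) = 0) → y = 0

/-- `(N, α, E)` is an asymptotic lift of `φ : M → M`: a nondegenerate reversible lift such that
`‖ρ ∘ E‖ = lim ‖ρ ∘ φᵏ‖` (norms of restrictions to the self-adjoint parts) for all `ρ` in the
predual of `M`. -/
structure IsAsymptoticLift {M : DualOperatorSystem H} (φ : UPMap M M) {N : DualOperatorSystem K}
    (α : UPIso N N) (E : UPMap N M) : Prop where
  reversible : IsReversibleLift φ α E
  nondegenerate : IsNondegenerateLift α E
  tendsto_saNorm : ∀ ρ : M →ₗ[ℂ] ℂ, DualOperatorSystem.IsNormalFunctional ρ →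
    Tendsto (fun k : ℕ => DualOperatorSystem.saNorm (ρ ∘ₗ (φ.toLinearMap ^ k))) atTop
      (𝓝 (DualOperatorSystem.saNorm (ρ ∘ₗ E.toLinearMap)))

/-- Inverse sequences: bounded bilateral sequences in `M` with `xₙ = φ (xₙ₊₁)`. -/
def IsInverseSequence {M : DualOperatorSystem H} (φ : UPMap M M) (x : ℤ → M) : Prop :=
  (∃ C : ℝ, ∀ n : ℤ, ‖(x n : H →L[ℂ] H)‖ ≤ C) ∧ ∀ n : ℤ, x n = φ (x (n + 1))

/-- `T` is the diagonal operator `(ξₙ) ↦ (xₙ ξₙ)` on the Hilbert space `ℓ²(ℤ; H)`. -/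
def IsDiagonalOf {M : DualOperatorSystem H}
    (T : lp (fun _ : ℤ => H) 2 →L[ℂ] lp (fun _ : ℤ => H) 2) (x : ℤ → M) : Prop :=
  ∀ (ξ : lp (fun _ : ℤ => H) 2) (n : ℤ), T ξ n = (x n : H →L[ℂ] H) (ξ n)

end Lifts

/-! Existence. Every coordinate of an inverse sequence satisfies `x₀ = φᵏ(xₖ)`, so `‖ρ ∘ E‖ ≤ ‖ρ ∘
φᵏ‖` on self-adjoint parts for all `k`. Conversely, choose self-adjoint contractions `zₖ` that
nearly norm `ρ ∘ φᵏ`. Balls are weak-star compact, so `φᵏ⁻ⁿ(zₖ)` has a limit `xₙ` along an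
ultrafilter in `k`; normality of `φ` makes `(xₙ)` an inverse sequence, and `ρ(x₀)` attains the
limiting norm (`exists_isInverseSequence_tendsto`).

Uniqueness. An element `y` of a lift is coded by the sequence `E(α⁻ⁿ y)`, `n ≥ 0`, and nondegeneracy
says that the code determines `y`. Two asymptotic lifts have the same codes: the norm condition
gives `‖ρ ∘ E₁‖ = ‖ρ ∘ E₂‖` for all normal `ρ`, and a separation argument on a compact ball shows
that `E₁` and `E₂` map the self-adjoint unit balls onto the same set (`exists_eq_of_saNorm_le`).
Applying this to `α₁⁻ᵏ y` and passing to a limit in `k` gives an element of the second lift with the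
code of `y` and no larger norm. Matching codes therefore defines a map `θ`; it is linear and unital
by uniqueness of codes, and positive because it is unital and contractive on self-adjoint elements.

Normality of `θ` is the delicate point. Compactness of balls and uniqueness of codes give continuity
on the unit ball only; a Krein–Šmulian theorem for functionals then gives continuity everywhere. It
comes from the same minimax principle: a ball-continuous functional is approximated by a vector
series to within half its norm bound, and the errors are corrected successively. -/

/-- A minimax principle: if `X` is compact, `S` is a convex set of continuous real functions on `X`
whose joint values are convex, and every member of `S` is nonnegative somewhere, then all members of
`S` are nonnegative at a common point. -/
theorem exists_forall_nonneg_of_convex {X : Type*} [TopologicalSpace X] [CompactSpace X]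
    [Nonempty X] {S : Set (X → ℝ)} (hS : Convex ℝ S) (hcont : ∀ s ∈ S, Continuous s)
    (hX : ∀ x y : X, ∀ a b : ℝ, 0 ≤ a → 0 ≤ b → a + b = 1 →
      ∃ z, ∀ s ∈ S, s z = a * s x + b * s y)
    (h : ∀ s ∈ S, ∃ x, 0 ≤ s x) : ∃ x, ∀ s ∈ S, 0 ≤ s x := by
  by_contra hcon
  push Not at hcon
  obtain ⟨t, ht⟩ := isCompact_univ.elim_finite_subcover (fun s : S => {x : X | s.1 x < 0})
    (fun s => isOpen_lt (hcont s.1 s.2) continuous_const) (fun x _ => by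
      obtain ⟨s, hs, hsx⟩ := hcon x
      exact Set.mem_iUnion.2 ⟨⟨s, hs⟩, hsx⟩)
  let W : X → (t → ℝ) := fun x i => i.1.1 x
  have hW : Continuous W := continuous_pi fun i => hcont _ i.1.2
  have hconv : Convex ℝ (Set.range W) := by
    rintro _ ⟨x, rfl⟩ _ ⟨y, rfl⟩ a b ha hb hab
    obtain ⟨z, hz⟩ := hX x y a b ha hb hab
    exact ⟨z, funext fun i => by simpa [W] using hz _ i.1.2⟩
  -- By the choice of the finite subcover, every `W x` has a negative coordinate.
  have hdisj : Disjoint (Set.range W) (Set.Ici (0 : t → ℝ)) := by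
    rw [Set.disjoint_left]
    rintro _ ⟨x, rfl⟩ hx
    obtain ⟨s, hs⟩ := Set.mem_iUnion.1 (ht (Set.mem_univ x))
    obtain ⟨hst, hsx⟩ := Set.mem_iUnion.1 hs
    exact absurd (hx ⟨s, hst⟩) (not_le.2 hsx)
  obtain ⟨f, u, v, hu, huv, hv⟩ := geometric_hahn_banach_compact_closed hconv
    (isCompact_range hW) (convex_Ici 0) isClosed_Ici hdisj
  have hv0 : v < 0 := by simpa using hv 0 (Set.mem_Ici.2 le_rfl)
  classical
  let w : t → ℝ := fun i => f (Pi.single i 1)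
  have hf : ∀ q : t → ℝ, f q = ∑ i, w i * q i := fun q => by
    conv_lhs => rw [pi_eq_sum_univ' q]
    simp only [map_sum, map_smul, smul_eq_mul, w]
    refine Finset.sum_congr rfl fun i _ => ?_
    rw [mul_comm]
  have hw : ∀ i, 0 ≤ w i := fun i => by
    by_contra hi
    push Not at hi
    -- With `w i` and `v` both negative this point lies in the orthant, yet `f` takes the value `v`
    -- there.
    have := hv (Pi.single i (v / w i)) (by
      rw [Set.mem_Ici, Pi.single_nonneg]
      exact (div_pos_of_neg_of_neg hv0 hi).le)
    rw [hf, Finset.sum_eq_single i (fun j _ hj => by simp [hj]) (by simp)] at this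
    rw [Pi.single_eq_same, mul_div_cancel₀ _ hi.ne] at this
    exact lt_irrefl _ this
  have hneg : ∀ x, ∑ i, w i * W x i < 0 := fun x => by
    rw [← hf]
    exact (hu _ ⟨x, rfl⟩).trans (huv.trans hv0)
  have hpos : 0 < ∑ i, w i := by
    refine (Finset.sum_nonneg fun i _ => hw i).lt_of_ne fun h0 => ?_
    have := (Finset.sum_eq_zero_iff_of_nonneg fun i _ => hw i).1 h0.symm
    have h1 := hneg (Classical.arbitrary X)
    rw [Finset.sum_eq_zero fun i hi => by rw [this i hi, zero_mul]] at h1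
    exact lt_irrefl _ h1
  have hmem : ∑ i, (w i / ∑ j, w j) • i.1.1 ∈ S :=
    hS.sum_mem (fun i _ => div_nonneg (hw i) hpos.le)
      (by rw [← Finset.sum_div, div_self hpos.ne']) (fun i _ => i.1.2)
  obtain ⟨x, hx⟩ := h _ hmem
  have h2 : (∑ i, (w i / ∑ j, w j) • i.1.1) x = (∑ i, w i * W x i) / ∑ j, w j := by
    rw [Finset.sum_apply, Finset.sum_div]
    refine Finset.sum_congr rfl fun i _ => ?_
    simp only [Pi.smul_apply, smul_eq_mul, W]
    ring
  rw [h2] at hx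
  exact absurd hx (not_le.2 (div_neg_of_neg_of_pos (hneg x) hpos))

/-! ### Operators on square-summable families -/

section SquareSummable

variable {ι : Type*} {H K : Type*} [NormedAddCommGroup H] [NormedAddCommGroup K]

theorem lp_two_summable_sq (ξ : lp (fun _ : ι => H) 2) : Summable fun i => ‖ξ i‖ ^ 2 := by
  simpa using (lp.memℓp ξ).summable (by norm_num)

theorem lp_two_norm_sq (ξ : lp (fun _ : ι => H) 2) : ‖ξ‖ ^ 2 = ∑' i, ‖ξ i‖ ^ 2 := by
  simpa using lp.norm_rpow_eq_tsum (p := 2) (by norm_num) ξ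

theorem memℓp_two_of_summable_sq {f : ι → H} (hf : Summable fun i => ‖f i‖ ^ 2) :
    Memℓp (fun i => f i) 2 :=
  memℓp_gen (by simpa using hf)

variable [InnerProductSpace ℂ H] [InnerProductSpace ℂ K]

/-- The diagonal operator between `ℓ²` spaces given by a uniformly bounded family of operators. -/
noncomputable def lpDiagonal (x : ι → H →L[ℂ] K) (C : ℝ) (hC : ∀ i, ‖x i‖ ≤ C) :
    lp (fun _ : ι => H) 2 →L[ℂ] lp (fun _ : ι => K) 2 :=
  -- `C` may be negative when the index type is empty, hence the `max C 0`.
  have hle : ∀ (ξ : lp (fun _ : ι => H) 2) i, ‖x i (ξ i)‖ ^ 2 ≤ (max C 0) ^ 2 * ‖ξ i‖ ^ 2 :=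
    fun ξ i => by
      rw [← mul_pow]
      gcongr
      exact (x i).le_of_opNorm_le ((hC i).trans (le_max_left _ _)) _
  have hsum : ∀ ξ : lp (fun _ : ι => H) 2, Summable fun i => ‖x i (ξ i)‖ ^ 2 := fun ξ =>
    ((lp_two_summable_sq ξ).mul_left _).of_nonneg_of_le (fun _ => by positivity) (hle ξ)
  LinearMap.mkContinuous
    { toFun := fun ξ => ⟨fun i => x i (ξ i), memℓp_two_of_summable_sq (hsum ξ)⟩
      map_add' := fun ξ η => by ext i; exact map_add (x i) _ _
      map_smul' := fun c ξ => by ext i; exact map_smul (x i) _ _ }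
    (max C 0) fun ξ => by
      refine le_of_sq_le_sq ?_ (by positivity)
      rw [mul_pow, lp_two_norm_sq, lp_two_norm_sq, ← tsum_mul_left]
      exact (hsum ξ).tsum_le_tsum (hle ξ) ((lp_two_summable_sq ξ).mul_left _)

@[simp] theorem lpDiagonal_apply (x : ι → H →L[ℂ] K) (C : ℝ) (hC : ∀ i, ‖x i‖ ≤ C)
    (ξ : lp (fun _ : ι => H) 2) (i : ι) : lpDiagonal x C hC ξ i = x i (ξ i) := rfl

theorem norm_lpDiagonal_le (x : ι → H →L[ℂ] K) (C : ℝ) (hC : ∀ i, ‖x i‖ ≤ C) (hC0 : 0 ≤ C) :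
    ‖lpDiagonal x C hC‖ ≤ C := by
  refine ContinuousLinearMap.opNorm_le_bound _ hC0 fun ξ => le_of_sq_le_sq ?_ (by positivity)
  rw [mul_pow, lp_two_norm_sq, lp_two_norm_sq, ← tsum_mul_left]
  refine (lp_two_summable_sq _).tsum_le_tsum (fun i => ?_) ((lp_two_summable_sq ξ).mul_left _)
  rw [← mul_pow]
  gcongr
  exact (x i).le_of_opNorm_le (hC i) _

/-- Reindexing an `ℓ²` space along a permutation of the index set. -/
noncomputable def lpReindex (e : ι ≃ ι) : lp (fun _ : ι => H) 2 →L[ℂ] lp (fun _ : ι => H) 2 :=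
  have hsum : ∀ ξ : lp (fun _ : ι => H) 2, Summable fun i => ‖ξ (e i)‖ ^ 2 := fun ξ =>
    (lp_two_summable_sq ξ).comp_injective e.injective
  LinearMap.mkContinuous
    { toFun := fun ξ => ⟨fun i => ξ (e i), memℓp_two_of_summable_sq (hsum ξ)⟩
      map_add' := fun ξ η => rfl
      map_smul' := fun c ξ => rfl }
    1 fun ξ => by
      refine le_of_sq_le_sq ?_ (by positivity)
      rw [mul_pow, lp_two_norm_sq, lp_two_norm_sq, one_pow, one_mul]
      exact (e.tsum_eq fun i => ‖ξ i‖ ^ 2).le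

@[simp] theorem lpReindex_apply (e : ι ≃ ι) (ξ : lp (fun _ : ι => H) 2) (i : ι) :
    lpReindex e ξ i = ξ (e i) := rfl

end SquareSummable

/-! ### Vector series functionals -/

section VectorSeries

variable {H K : Type*} [NormedAddCommGroup H] [InnerProductSpace ℂ H]
  [NormedAddCommGroup K] [InnerProductSpace ℂ K]

theorem vectorSeriesFunctional_add (ξ η : lp (fun _ : ℕ => H) 2) (S T : H →L[ℂ] H) :
    vectorSeriesFunctional ξ η (S + T) =
      vectorSeriesFunctional ξ η S + vectorSeriesFunctional ξ η T := by
  simp only [vectorSeriesFunctional, add_apply, inner_add_right]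
  exact (summable_vectorSeriesFunctional ξ η S).of_norm.tsum_add
    (summable_vectorSeriesFunctional ξ η T).of_norm

theorem vectorSeriesFunctional_smul (ξ η : lp (fun _ : ℕ => H) 2) (c : ℂ) (T : H →L[ℂ] H) :
    vectorSeriesFunctional ξ η (c • T) = c * vectorSeriesFunctional ξ η T := by
  simp only [vectorSeriesFunctional, smul_apply, inner_smul_right,
    tsum_mul_left]

/-- `vectorSeriesFunctional` as a linear functional. -/
noncomputable def vectorSeriesLinear (ξ η : lp (fun _ : ℕ => H) 2) : (H →L[ℂ] H) →ₗ[ℂ] ℂ where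
  toFun := vectorSeriesFunctional ξ η
  map_add' := vectorSeriesFunctional_add ξ η
  map_smul' := vectorSeriesFunctional_smul ξ η

@[simp] theorem vectorSeriesLinear_apply (ξ η : lp (fun _ : ℕ => H) 2) (T : H →L[ℂ] H) :
    vectorSeriesLinear ξ η T = vectorSeriesFunctional ξ η T := rfl

/-- Countably many vector series can be merged into one. -/
theorem exists_vectorSeriesFunctional_hasSum {ι : Type*} [Countable ι]
    (ξ η : ι → lp (fun _ : ℕ => H) 2) (hξ : Summable fun i => ‖ξ i‖ ^ 2)
    (hη : Summable fun i => ‖η i‖ ^ 2) :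
    ∃ ξ' η' : lp (fun _ : ℕ => H) 2, ‖ξ'‖ ^ 2 = ∑' i, ‖ξ i‖ ^ 2 ∧ ‖η'‖ ^ 2 = ∑' i, ‖η i‖ ^ 2 ∧
      ∀ T, HasSum (fun i => vectorSeriesFunctional (ξ i) (η i) T)
        (vectorSeriesFunctional ξ' η' T) := by
  -- The double family is laid out along an injection into `ℕ` and padded with zeros, which treats
  -- finite and infinite `ι` alike.
  obtain ⟨e, he⟩ := exists_injective_nat (ι × ℕ)
  have key : ∀ ζ : ι → lp (fun _ : ℕ => H) 2, (Summable fun i => ‖ζ i‖ ^ 2) →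
      ∃ ζ' : lp (fun _ : ℕ => H) 2, ‖ζ'‖ ^ 2 = ∑' i, ‖ζ i‖ ^ 2 ∧
        (∀ p : ι × ℕ, ζ' (e p) = ζ p.1 p.2) ∧ ∀ n, n ∉ Set.range e → ζ' n = 0 := by
    intro ζ hζ
    have h1 : Summable fun p : ι × ℕ => ‖ζ p.1 p.2‖ ^ 2 := by
      rw [summable_prod_of_nonneg (fun p => by positivity)]
      exact ⟨fun i => lp_two_summable_sq (ζ i), by simpa only [← lp_two_norm_sq] using hζ⟩
    let f : ℕ → H := Function.extend e (fun p => ζ p.1 p.2) 0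
    have hf1 : ∀ p, f (e p) = ζ p.1 p.2 := fun p => he.extend_apply _ _ p
    have hf2 : ∀ n, n ∉ Set.range e → f n = 0 := fun n hn =>
      Function.extend_apply' _ _ _ fun ⟨p, hp⟩ => hn ⟨p, hp⟩
    have h2 : Summable fun n => ‖f n‖ ^ 2 := by
      rw [← he.summable_iff (fun n hn => by rw [hf2 n hn]; simp)]
      simpa only [Function.comp_def, hf1] using h1
    refine ⟨⟨f, memℓp_two_of_summable_sq h2⟩, ?_, hf1, hf2⟩
    rw [lp_two_norm_sq]
    simp only [lp_two_norm_sq]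
    rw [← h1.tsum_prod, ← he.tsum_eq]
    · exact tsum_congr fun p => congrArg (fun v => ‖v‖ ^ 2) (hf1 p)
    · intro n hn
      by_contra hn'
      exact hn (by simp [hf2 n hn'])
  obtain ⟨ξ', hξn, hξ1, hξ2⟩ := key ξ hξ
  obtain ⟨η', hηn, hη1, hη2⟩ := key η hη
  refine ⟨ξ', η', hξn, hηn, fun T => ?_⟩
  have hs : HasSum (fun n => (inner ℂ (ξ' n) (T (η' n)) : ℂ)) (vectorSeriesFunctional ξ' η' T) :=
    (summable_vectorSeriesFunctional ξ' η' T).of_norm.hasSum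
  rw [← he.hasSum_iff (fun n hn => by rw [hξ2 n hn, inner_zero_left])] at hs
  simp only [Function.comp_def, hξ1, hη1] at hs
  exact hs.prod_fiberwise fun i => (summable_vectorSeriesFunctional (ξ i) (η i) T).of_norm.hasSum

theorem vectorSeriesFunctional_single (v w : H) (T : H →L[ℂ] H) :
    vectorSeriesFunctional (lp.single 2 0 v) (lp.single 2 0 w) T = inner ℂ v (T w) := by
  rw [vectorSeriesFunctional, tsum_eq_single 0]
  · simp
  · intro n hn
    simp [hn]

theorem eq_of_vectorSeriesFunctional_eq {S T : H →L[ℂ] H}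
    (h : ∀ ξ η, vectorSeriesFunctional ξ η S = vectorSeriesFunctional ξ η T) : S = T := by
  ext w
  refine ext_inner_left ℂ fun v => ?_
  simpa only [vectorSeriesFunctional_single] using h (lp.single 2 0 v) (lp.single 2 0 w)

/-- The outer operators move onto the vectors, as `A*` on `ξ` and `B` on `η`. This makes
compressions and conjugations ultraweakly continuous. -/
theorem vectorSeriesFunctional_conj [CompleteSpace H] [CompleteSpace K] (A : K →L[ℂ] H)
    (B : H →L[ℂ] K) (ξ η : lp (fun _ : ℕ => H) 2) :
    ∃ ξ' η' : lp (fun _ : ℕ => K) 2, ∀ T : K →L[ℂ] K,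
      vectorSeriesFunctional ξ η (A ∘L T ∘L B) = vectorSeriesFunctional ξ' η' T := by
  refine ⟨lpDiagonal (fun _ => A.adjoint) _ (fun _ => le_rfl) ξ,
    lpDiagonal (fun _ => B) _ (fun _ => le_rfl) η, fun T => ?_⟩
  simp [vectorSeriesFunctional, ContinuousLinearMap.adjoint_inner_left]

end VectorSeries

/-! ### Ultraweak convergence and compactness -/

section WeakStar

variable {H : Type*} [NormedAddCommGroup H] [InnerProductSpace ℂ H]

theorem tendsto_ultraweak_iff {ι : Type*} {l : Filter ι} {x : ι → H →L[ℂ] H} {z : H →L[ℂ] H} :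
    Tendsto x l (@nhds _ (ultraweakTopology H) z) ↔
      ∀ ξ η, Tendsto (fun i => vectorSeriesFunctional ξ η (x i)) l
        (𝓝 (vectorSeriesFunctional ξ η z)) := by
  simp only [nhds_iInf, nhds_induced, tendsto_iInf, tendsto_comap_iff,
    Function.comp_def]

theorem tendsto_inner_of_tendsto_ultraweak {ι : Type*} {l : Filter ι} {x : ι → H →L[ℂ] H}
    {z : H →L[ℂ] H} (h : Tendsto x l (@nhds _ (ultraweakTopology H) z)) (v w : H) :
    Tendsto (fun i => (inner ℂ v (x i w) : ℂ)) l (𝓝 (inner ℂ v (z w))) := by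
  simpa only [vectorSeriesFunctional_single] using
    tendsto_ultraweak_iff.1 h (lp.single 2 0 v) (lp.single 2 0 w)

theorem tendsto_ultraweak_unique {ι : Type*} {l : Filter ι} [l.NeBot] {x : ι → H →L[ℂ] H}
    {z z' : H →L[ℂ] H} (h : Tendsto x l (@nhds _ (ultraweakTopology H) z))
    (h' : Tendsto x l (@nhds _ (ultraweakTopology H) z')) : z = z' :=
  eq_of_vectorSeriesFunctional_eq fun ξ η =>
    tendsto_nhds_unique (tendsto_ultraweak_iff.1 h ξ η) (tendsto_ultraweak_iff.1 h' ξ η)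

theorem tendsto_ultraweak_conj {K : Type*} [NormedAddCommGroup K] [InnerProductSpace ℂ K]
    [CompleteSpace H] [CompleteSpace K] (A : K →L[ℂ] H)
    (B : H →L[ℂ] K) {ι : Type*} {l : Filter ι} {x : ι → K →L[ℂ] K}
    {z : K →L[ℂ] K} (h : Tendsto x l (@nhds _ (ultraweakTopology K) z)) :
    Tendsto (fun i => A ∘L x i ∘L B) l (@nhds _ (ultraweakTopology H) (A ∘L z ∘L B)) := by
  refine tendsto_ultraweak_iff.2 fun ξ η => ?_
  obtain ⟨ξ', η', h'⟩ := vectorSeriesFunctional_conj A B ξ η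
  simpa only [h'] using tendsto_ultraweak_iff.1 h ξ' η'

theorem norm_le_of_tendsto_ultraweak {ι : Type*} {l : Filter ι} [l.NeBot] {x : ι → H →L[ℂ] H}
    {z : H →L[ℂ] H} (h : Tendsto x l (@nhds _ (ultraweakTopology H) z)) {C : ℝ}
    (hC : ∀ᶠ i in l, ‖x i‖ ≤ C) : ‖z‖ ≤ C := by
  have hC0 : 0 ≤ C := by
    obtain ⟨i, hi⟩ := hC.exists
    exact (norm_nonneg _).trans hi
  refine ContinuousLinearMap.opNorm_le_bound _ hC0 fun w => ?_
  -- Testing against the limit vector `z w` itself gives lower semicontinuity of the norm.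
  have h1 : ‖(inner ℂ (z w) (z w) : ℂ)‖ ≤ ‖z w‖ * (C * ‖w‖) :=
    le_of_tendsto (tendsto_inner_of_tendsto_ultraweak h (z w) w).norm (hC.mono fun i hi =>
      (norm_inner_le_norm _ _).trans (by gcongr; exact (x i).le_of_opNorm_le hi w))
  rw [inner_self_eq_norm_sq_to_K, norm_pow, RCLike.norm_ofReal, abs_norm, sq] at h1
  rcases (norm_nonneg (z w)).eq_or_lt with h0 | h0
  · rw [← h0]; positivity
  · exact le_of_mul_le_mul_left h1 h0

theorem isSelfAdjoint_of_tendsto_ultraweak [CompleteSpace H] {ι : Type*} {l : Filter ι} [l.NeBot]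
    {x : ι → H →L[ℂ] H} {z : H →L[ℂ] H} (h : Tendsto x l (@nhds _ (ultraweakTopology H) z))
    (hx : ∀ᶠ i in l, IsSelfAdjoint (x i)) : IsSelfAdjoint z := by
  rw [ContinuousLinearMap.isSelfAdjoint_iff']
  ext w
  refine ext_inner_left ℂ fun v => ?_
  rw [ContinuousLinearMap.adjoint_inner_right]
  have h1 := tendsto_inner_of_tendsto_ultraweak h v w
  have h2 := (tendsto_inner_of_tendsto_ultraweak h w v).star
  simp only [RCLike.star_def, inner_conj_symm] at h2
  refine tendsto_nhds_unique h2 (h1.congr' (hx.mono fun i hi => ?_))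
  have := ContinuousLinearMap.adjoint_inner_right (x i) v w
  rwa [ContinuousLinearMap.isSelfAdjoint_iff'.1 hi] at this

/-- Norm-bounded families of operators converge ultraweakly along ultrafilters. -/
theorem exists_tendsto_ultraweak [CompleteSpace H] {ι : Type*} (F : Ultrafilter ι)
    {x : ι → H →L[ℂ] H} {C : ℝ} (hC : ∀ i, ‖x i‖ ≤ C) :
    ∃ z, Tendsto x F (@nhds _ (ultraweakTopology H) z) := by
  have hC0 : 0 ≤ C := by
    obtain ⟨i, -⟩ := F.nonempty_of_mem univ_mem
    exact (norm_nonneg _).trans (hC i)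
  have hbd : ∀ v w i, ‖(inner ℂ (x i v) w : ℂ)‖ ≤ C * ‖v‖ * ‖w‖ := fun v w i =>
    (norm_inner_le_norm _ _).trans (by gcongr; exact (x i).le_of_opNorm_le (hC i) v)
  have hlim : ∀ v w, ∃ b ∈ Metric.closedBall (0 : ℂ) (C * ‖v‖ * ‖w‖),
      Tendsto (fun i => (inner ℂ (x i v) w : ℂ)) F (𝓝 b) := fun v w =>
    (isCompact_closedBall (0 : ℂ) _).ultrafilter_le_nhds'
      (F.map fun i => (inner ℂ (x i v) w : ℂ))
      (Ultrafilter.mem_map.2 (univ_mem' fun i => by simpa using hbd v w i))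
  choose b hb hbt using hlim
  have hadd : ∀ v v' w, b (v + v') w = b v w + b v' w := fun v v' w =>
    tendsto_nhds_unique (hbt _ _) (by
      simpa only [map_add, inner_add_left] using (hbt v w).add (hbt v' w))
  have hsmul : ∀ (c : ℂ) v w, b (c • v) w = (starRingEnd ℂ) c • b v w := fun c v w =>
    tendsto_nhds_unique (hbt _ _) (by
      simpa only [map_smul, inner_smul_left, smul_eq_mul] using
        (hbt v w).const_mul ((starRingEnd ℂ) c))
  have hadd' : ∀ v w w', b v (w + w') = b v w + b v w' := fun v w w' =>
    tendsto_nhds_unique (hbt _ _) (by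
      simpa only [inner_add_right] using (hbt v w).add (hbt v w'))
  have hsmul' : ∀ (c : ℂ) v w, b v (c • w) = (RingHom.id ℂ) c • b v w := fun c v w =>
    tendsto_nhds_unique (hbt _ _) (by
      simpa only [inner_smul_right, smul_eq_mul, RingHom.id_apply] using (hbt v w).const_mul c)
  -- The limits of the matrix coefficients form a bounded sesquilinear form, which an operator
  -- represents.
  let B : H →L⋆[ℂ] H →L[ℂ] ℂ := (LinearMap.mk₂'ₛₗ (starRingEnd ℂ) (RingHom.id ℂ) b hadd hsmul
    hadd' hsmul').mkContinuous₂ C fun v w => by simpa using hb v w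
  have hB : ∀ v w, (inner ℂ (InnerProductSpace.continuousLinearMapOfBilin B v) w : ℂ) = b v w :=
    fun v w => InnerProductSpace.continuousLinearMapOfBilin_apply B v w
  set z := InnerProductSpace.continuousLinearMapOfBilin B
  refine ⟨z, tendsto_ultraweak_iff.2 fun ξ η => ?_⟩
  -- The uniform norm bound dominates the series, so convergence of matrix coefficients upgrades to
  -- ultraweak convergence.
  refine tendsto_tsum_of_dominated_convergence
    (bound := fun n => C * (‖ξ n‖ ^ 2 + ‖η n‖ ^ 2))
    (((lp_two_summable_sq ξ).add (lp_two_summable_sq η)).mul_left C) (fun n => ?_)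
    (univ_mem' fun i n => ?_)
  · have := (hbt (η n) (ξ n)).star
    rw [← hB] at this
    simpa only [RCLike.star_def, inner_conj_symm] using this
  · have h := hbd (η n) (ξ n) i
    rw [norm_inner_symm] at h
    refine h.trans ?_
    rw [mul_assoc]
    gcongr
    nlinarith [sq_nonneg (‖ξ n‖ - ‖η n‖), sq_nonneg (‖ξ n‖), sq_nonneg (‖η n‖)]

end WeakStar

/-! ### Normal functionals and weak-star compact balls -/

namespace DualOperatorSystem

variable {H : Type*} [NormedAddCommGroup H] [InnerProductSpace ℂ H] [CompleteSpace H]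
  {M : DualOperatorSystem H}

theorem tendsto_weakStar_iff {ι : Type*} {l : Filter ι} {x : ι → M} {z : M} :
    Tendsto x l (@nhds _ M.weakStar z) ↔
      Tendsto (fun i => (x i : H →L[ℂ] H)) l (@nhds _ (ultraweakTopology H) z) := by
  rw [@nhds_induced _ _ (ultraweakTopology H), tendsto_comap_iff, Function.comp_def]

theorem tendsto_weakStar_unique {ι : Type*} {l : Filter ι} [l.NeBot] {x : ι → M} {z z' : M}
    (h : Tendsto x l (@nhds _ M.weakStar z)) (h' : Tendsto x l (@nhds _ M.weakStar z')) :
    z = z' :=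
  Subtype.ext (tendsto_ultraweak_unique (tendsto_weakStar_iff.1 h) (tendsto_weakStar_iff.1 h'))

theorem isNormalFunctional_iff {ρ : M →ₗ[ℂ] ℂ} : IsNormalFunctional ρ ↔
    ∀ z : M, Tendsto ρ (@nhds _ M.weakStar z) (𝓝 (ρ z)) :=
  @continuous_iff_continuousAt _ _ M.weakStar _ _

theorem IsNormalFunctional.tendsto {ρ : M →ₗ[ℂ] ℂ} (hρ : IsNormalFunctional ρ) {ι : Type*}
    {l : Filter ι} {x : ι → M} {z : M} (h : Tendsto x l (@nhds _ M.weakStar z)) :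
    Tendsto (fun i => ρ (x i)) l (𝓝 (ρ z)) :=
  (isNormalFunctional_iff.1 hρ z).comp h

theorem isNormalFunctional_vectorSeries (ξ η : lp (fun _ : ℕ => H) 2) :
    IsNormalFunctional (vectorSeriesLinear ξ η ∘ₗ M.toSubmodule.subtype) :=
  isNormalFunctional_iff.2 fun _ => tendsto_ultraweak_iff.1
    (tendsto_weakStar_iff.1 tendsto_id) ξ η

theorem mem_of_tendsto_ultraweak {ι : Type*} {l : Filter ι} [l.NeBot] {x : ι → M}
    {z : H →L[ℂ] H} (h : Tendsto (fun i => (x i : H →L[ℂ] H)) l (@nhds _ (ultraweakTopology H) z)) :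
    z ∈ M.toSubmodule :=
  @IsClosed.mem_of_tendsto _ (ultraweakTopology H) _ _ _ _ _ _ M.isClosed' h
    (univ_mem' fun i => (x i).2)

/-- The balls of a dual operator system are weak-star compact, in terms of ultrafilters. -/
theorem exists_tendsto_weakStar {ι : Type*} (F : Ultrafilter ι) {x : ι → M} {C : ℝ}
    (hC : ∀ i, ‖(x i : H →L[ℂ] H)‖ ≤ C) :
    ∃ z : M, ‖(z : H →L[ℂ] H)‖ ≤ C ∧ Tendsto x F (@nhds _ M.weakStar z) := by
  obtain ⟨z, hz⟩ := exists_tendsto_ultraweak F hC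
  exact ⟨⟨z, mem_of_tendsto_ultraweak hz⟩,
    norm_le_of_tendsto_ultraweak hz (univ_mem' hC), tendsto_weakStar_iff.2 hz⟩

theorem exists_tendsto_weakStar_selfAdjoint {ι : Type*} (F : Ultrafilter ι) {x : ι → M} {C : ℝ}
    (hC : ∀ i, IsSelfAdjoint (x i : H →L[ℂ] H) ∧ ‖(x i : H →L[ℂ] H)‖ ≤ C) :
    ∃ z : M, (IsSelfAdjoint (z : H →L[ℂ] H) ∧ ‖(z : H →L[ℂ] H)‖ ≤ C) ∧
      Tendsto x F (@nhds _ M.weakStar z) := by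
  obtain ⟨z, hz, h⟩ := exists_tendsto_weakStar F fun i => (hC i).2
  exact ⟨z, ⟨isSelfAdjoint_of_tendsto_ultraweak (tendsto_weakStar_iff.1 h)
    (univ_mem' fun i => (hC i).1), hz⟩, h⟩

end DualOperatorSystem

/-! ### A Krein–Šmulian theorem for functionals -/

namespace DualOperatorSystem

variable {H : Type*} [NormedAddCommGroup H] [InnerProductSpace ℂ H] [CompleteSpace H]
  {M : DualOperatorSystem H}

/-- The linear functional `f` is weak-star continuous on the unit ball of `M`. -/
def IsBallContinuous (f : M →ₗ[ℂ] ℂ) : Prop :=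
  ∀ (F : Ultrafilter M) (z : M), (∀ᶠ x : M in F, ‖(x : H →L[ℂ] H)‖ ≤ 1) →
    ↑F ≤ @nhds _ M.weakStar z → Tendsto f F (𝓝 (f z))

theorem IsNormalFunctional.isBallContinuous {ρ : M →ₗ[ℂ] ℂ} (hρ : IsNormalFunctional ρ) :
    IsBallContinuous ρ := fun _ _ _ h => hρ.tendsto (tendsto_id'.2 h)

theorem norm_le_of_re_le {f : M →ₗ[ℂ] ℂ} {δ : ℝ}
    (h : ∀ x : M, ‖(x : H →L[ℂ] H)‖ ≤ 1 → (f x).re ≤ δ) (x : M) :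
    ‖f x‖ ≤ δ * ‖(x : H →L[ℂ] H)‖ := by
  rcases eq_or_ne x 0 with rfl | hx
  · simp
  have hx' : 0 < ‖(x : H →L[ℂ] H)‖ := norm_pos_iff.2 fun h0 => hx (Subtype.ext h0)
  obtain ⟨c, hc, hcx⟩ := RCLike.exists_norm_eq_mul_self (f x)
  have h1 := h ((c * ((‖(x : H →L[ℂ] H)‖⁻¹ : ℝ) : ℂ)) • x) (by
    rw [Submodule.coe_smul, norm_smul, norm_mul, hc, Complex.norm_real, norm_inv, norm_norm,
      one_mul, inv_mul_cancel₀ hx'.ne'])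
  have h2 : f ((c * ((‖(x : H →L[ℂ] H)‖⁻¹ : ℝ) : ℂ)) • x) =
      ((‖f x‖ * ‖(x : H →L[ℂ] H)‖⁻¹ : ℝ) : ℂ) := by
    rw [map_smul, smul_eq_mul, Complex.ofReal_mul, show ((‖f x‖ : ℝ) : ℂ) = c * f x from hcx]
    ring
  rw [h2, Complex.ofReal_re] at h1
  rwa [← div_eq_mul_inv, div_le_iff₀ hx'] at h1

/-- If no such `ω` exists, then for each admissible vector series `ω` some `x` in the unit ball has
`Re (f - ω)(x) > r/2`. Minimax yields a single `x` with `Re ω(x) ≤ Re f(x) - r/2` for all `ω`.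
Taking `ω` of the form `r⟨v, · w⟩` with unit vectors gives `r‖x‖ ≤ Re f(x) - r/2`, contradicting
`|f(x)| ≤ r‖x‖`. -/
theorem exists_vectorSeriesFunctional_approx {f : M →ₗ[ℂ] ℂ} (hf : IsBallContinuous f) {r : ℝ}
    (hr : 0 < r) (hbd : ∀ x, ‖f x‖ ≤ r * ‖(x : H →L[ℂ] H)‖) :
    ∃ ξ η : lp (fun _ : ℕ => H) 2, ‖ξ‖ ^ 2 ≤ r ∧ ‖η‖ ^ 2 ≤ r ∧
      ∀ x : M, ‖f x - vectorSeriesFunctional ξ η x‖ ≤ r / 2 * ‖(x : H →L[ℂ] H)‖ := by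
  by_contra hcon
  let X := {x : M // ‖(x : H →L[ℂ] H)‖ ≤ 1}
  let _ : TopologicalSpace X := TopologicalSpace.induced Subtype.val M.weakStar
  have hnhds : ∀ (F : Filter X) (z : X), F ≤ 𝓝 z ↔
      Tendsto Subtype.val F (@nhds _ M.weakStar z.1) := fun F z => by
    rw [@nhds_induced _ _ M.weakStar, ← tendsto_iff_comap]
  have : CompactSpace X := ⟨isCompact_iff_ultrafilter_le_nhds.2 fun F _ => by
    obtain ⟨z, hz, h⟩ := exists_tendsto_weakStar F (x := Subtype.val) fun x : X => x.2
    exact ⟨⟨z, hz⟩, Set.mem_univ _, (hnhds _ _).2 h⟩⟩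
  have : Nonempty X := ⟨⟨0, by simp⟩⟩
  have hcont : ∀ {g : M →ₗ[ℂ] ℂ}, IsBallContinuous g → Continuous fun x : X => g x.1 :=
    fun {g} hg => continuous_iff_ultrafilter.2 fun z F h =>
      hg (F.map Subtype.val) z.1 (eventually_map.2 (.of_forall fun x : X => x.2)) ((hnhds _ _).1 h)
  let S : Set (X → ℝ) := {s | ∃ ξ η : lp (fun _ : ℕ => H) 2, ‖ξ‖ ^ 2 ≤ r ∧ ‖η‖ ^ 2 ≤ r ∧
    s = fun x => (f x.1).re - (vectorSeriesFunctional ξ η x.1).re - r / 2}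
  have hS : Convex ℝ S := by
    rintro _ ⟨ξ₁, η₁, hξ₁, hη₁, rfl⟩ _ ⟨ξ₂, η₂, hξ₂, hη₂, rfl⟩ a b ha hb hab
    -- The functional is quadratic in the pair of vectors, so a weight enters as its square root on
    -- both sides; the norm constraints are then preserved by convexity.
    let c : Bool → ℝ := fun i => cond i a b
    have hc : ∀ i, 0 ≤ c i := by rintro (_ | _) <;> assumption
    have hnorm : ∀ (i : Bool) (ζ : lp (fun _ : ℕ => H) 2),
        ‖((√(c i) : ℝ) : ℂ) • ζ‖ ^ 2 = c i * ‖ζ‖ ^ 2 := fun i ζ => by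
      rw [norm_smul, mul_pow, Complex.norm_real, Real.norm_eq_abs, sq_abs, Real.sq_sqrt (hc i)]
    obtain ⟨ξ, η, hξ, hη, h⟩ := exists_vectorSeriesFunctional_hasSum
      (fun i : Bool => ((√(c i) : ℝ) : ℂ) • cond i ξ₁ ξ₂)
      (fun i : Bool => ((√(c i) : ℝ) : ℂ) • cond i η₁ η₂)
      (Summable.of_finite) (Summable.of_finite)
    simp only [hnorm, tsum_fintype, Fintype.sum_bool, cond_true, cond_false, c] at hξ hη
    refine ⟨ξ, η, by rw [hξ]; nlinarith, by rw [hη]; nlinarith, funext fun x => ?_⟩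
    have h1 := (hasSum_fintype _).unique (h x.1)
    have h2 : ∀ (i : Bool) (ξ η : lp (fun _ : ℕ => H) 2) (T : H →L[ℂ] H),
        vectorSeriesFunctional (((√(c i) : ℝ) : ℂ) • ξ) (((√(c i) : ℝ) : ℂ) • η) T =
          c i * vectorSeriesFunctional ξ η T := fun i ξ η T => by
      simp only [vectorSeriesFunctional, lp.coeFn_smul, Pi.smul_apply, map_smul, inner_smul_left,
        inner_smul_right, Complex.conj_ofReal, tsum_mul_left, ← mul_assoc, ← Complex.ofReal_mul,
        Real.mul_self_sqrt (hc i)]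
    simp only [h2, Fintype.sum_bool, cond_true, cond_false, c] at h1
    rw [← h1]
    simp only [Pi.add_apply, Pi.smul_apply, smul_eq_mul, Complex.add_re, Complex.re_ofReal_mul]
    obtain rfl : b = 1 - a := by linarith
    ring
  obtain ⟨x, hx⟩ := exists_forall_nonneg_of_convex hS (by
      rintro _ ⟨ξ, η, -, -, rfl⟩
      exact ((Complex.continuous_re.comp (hcont hf)).sub (Complex.continuous_re.comp
        (hcont (isNormalFunctional_vectorSeries ξ η).isBallContinuous))).sub continuous_const)
    (by
      intro x y a b ha hb hab
      refine ⟨⟨(a : ℂ) • x.1 + (b : ℂ) • y.1, ?_⟩, ?_⟩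
      · calc ‖(a : ℂ) • (x.1 : H →L[ℂ] H) + (b : ℂ) • (y.1 : H →L[ℂ] H)‖
            ≤ a * ‖(x.1 : H →L[ℂ] H)‖ + b * ‖(y.1 : H →L[ℂ] H)‖ := by
              refine (norm_add_le _ _).trans_eq ?_
              rw [norm_smul, norm_smul, Complex.norm_of_nonneg ha, Complex.norm_of_nonneg hb]
          _ ≤ a * 1 + b * 1 := by
              have := x.2
              have := y.2
              gcongr
          _ = 1 := by linarith
      · rintro _ ⟨ξ, η, -, -, rfl⟩
        simp only [map_add, map_smul, Submodule.coe_add, Submodule.coe_smul,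
          vectorSeriesFunctional_add, vectorSeriesFunctional_smul, smul_eq_mul, Complex.add_re,
          Complex.re_ofReal_mul]
        obtain rfl : b = 1 - a := by linarith
        ring)
    (by
      rintro _ ⟨ξ, η, hξ, hη, rfl⟩
      by_contra hneg
      push Not at hneg
      refine hcon ⟨ξ, η, hξ, hη, fun x => ?_⟩
      exact norm_le_of_re_le (f := f - vectorSeriesLinear ξ η ∘ₗ M.toSubmodule.subtype)
        (fun y hy => by
          have := hneg ⟨y, hy⟩
          simp only [LinearMap.sub_apply, LinearMap.comp_apply, Submodule.subtype_apply,
            vectorSeriesLinear_apply, Complex.sub_re]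
          linarith) x)
  -- The zero functional shows that the bound claimed for `‖x‖` is nonnegative.
  have h0 := hx _ ⟨0, 0, by simpa using hr.le, by simpa using hr.le, rfl⟩
  have hle : ‖(x.1 : H →L[ℂ] H)‖ ≤ ((f x.1).re - r / 2) / r := by
    refine ContinuousLinearMap.opNorm_le_of_re_inner_le (div_nonneg ?_ hr.le) fun w v hw hv => ?_
    · simpa [vectorSeriesFunctional] using h0
    · have hn : ∀ u : H, ‖u‖ = 1 → ‖lp.single (E := fun _ : ℕ => H) 2 0 (((√r : ℝ) : ℂ) • u)‖ ^ 2
          ≤ r := fun u hu => by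
        rw [lp.norm_single (by norm_num), norm_smul, hu, mul_one, Complex.norm_real,
          Real.norm_eq_abs, sq_abs, Real.sq_sqrt hr.le]
      have := hx _ ⟨_, _, hn v hv, hn w hw, rfl⟩
      rw [vectorSeriesFunctional_single, map_smul, inner_smul_left, inner_smul_right,
        Complex.conj_ofReal, ← mul_assoc, ← Complex.ofReal_mul, Real.mul_self_sqrt hr.le,
        Complex.re_ofReal_mul] at this
      rw [le_div_iff₀ hr, ← inner_re_symm, mul_comm]
      change r * (inner ℂ v (x.1.1 w) : ℂ).re ≤ _
      linarith
  rw [le_div_iff₀ hr] at hle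
  have h3 := (Complex.re_le_norm (f x.1)).trans (hbd x.1)
  linarith

/-- The Krein–Šmulian theorem for functionals: a bounded functional on a dual operator system which
is weak-star continuous on the unit ball is given by a vector series. -/
theorem IsBallContinuous.exists_eq_vectorSeriesFunctional {f : M →ₗ[ℂ] ℂ}
    (hf : IsBallContinuous f) {C : ℝ} (hC : ∀ x, ‖f x‖ ≤ C * ‖(x : H →L[ℂ] H)‖) :
    ∃ ξ η : lp (fun _ : ℕ => H) 2, ∀ x : M, f x = vectorSeriesFunctional ξ η x := by
  obtain ⟨r, hr, hbd⟩ : ∃ r : ℝ, 0 < r ∧ ∀ x, ‖f x‖ ≤ r * ‖(x : H →L[ℂ] H)‖ :=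
    ⟨max C 1, by positivity, fun x => (hC x).trans (by gcongr; exact le_max_left _ _)⟩
  -- The invariant of the successive approximation: the `n`-th remainder is still ball-continuous
  -- and its norm bound has been halved `n` times.
  let P : ℕ → (M →ₗ[ℂ] ℂ) → Prop := fun n g =>
    IsBallContinuous g ∧ ∀ x, ‖g x‖ ≤ r / 2 ^ n * ‖(x : H →L[ℂ] H)‖
  have hstep : ∀ n g, ∃ ξ η : lp (fun _ : ℕ => H) 2, P n g →
      ‖ξ‖ ^ 2 ≤ r / 2 ^ n ∧ ‖η‖ ^ 2 ≤ r / 2 ^ n ∧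
        P (n + 1) (g - vectorSeriesLinear ξ η ∘ₗ M.toSubmodule.subtype) := by
    intro n g
    by_cases hg : P n g
    · obtain ⟨ξ, η, hξ, hη, h⟩ := exists_vectorSeriesFunctional_approx hg.1
        (show 0 < r / 2 ^ n by positivity) hg.2
      refine ⟨ξ, η, fun _ => ⟨hξ, hη, ?_, fun x => ?_⟩⟩
      · exact fun F z hF hz => (hg.1 F z hF hz).sub
          ((isNormalFunctional_vectorSeries ξ η).isBallContinuous F z hF hz)
      · rw [pow_succ, ← div_div]
        exact h x
    · exact ⟨0, 0, fun h => absurd h hg⟩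
  choose Ξ Θ hΞ using hstep
  let g : ℕ → (M →ₗ[ℂ] ℂ) := fun n => Nat.rec f
    (fun n g => g - vectorSeriesLinear (Ξ n g) (Θ n g) ∘ₗ M.toSubmodule.subtype) n
  have hP : ∀ n, P n (g n) := fun n => by
    induction n with
    | zero => exact ⟨hf, by simpa [g] using hbd⟩
    | succ n ih => exact (hΞ n (g n) ih).2.2
  have hsum : Summable fun n : ℕ => r / 2 ^ n := by
    simpa [div_eq_mul_inv] using (summable_geometric_of_lt_one (r := (2 : ℝ)⁻¹) (by norm_num)
      (by norm_num)).mul_left r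
  obtain ⟨ξ, η, -, -, h⟩ := exists_vectorSeriesFunctional_hasSum (fun n => Ξ n (g n))
    (fun n => Θ n (g n))
    (hsum.of_nonneg_of_le (fun _ => by positivity) fun n => (hΞ n (g n) (hP n)).1)
    (hsum.of_nonneg_of_le (fun _ => by positivity) fun n => (hΞ n (g n) (hP n)).2.1)
  refine ⟨ξ, η, fun x => tendsto_nhds_unique (f := fun n => f x - g n x) ?_
    ((h x).tendsto_sum_nat.congr fun n => ?_)⟩
  · have h0 : Tendsto (fun n => g n x) atTop (𝓝 0) :=
      squeeze_zero_norm (fun n => (hP n).2 x)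
        (by simpa using hsum.tendsto_atTop_zero.mul_const ‖(x : H →L[ℂ] H)‖)
    simpa using h0.const_sub (f x)
  · induction n with
    | zero => simp [g]
    | succ n ih =>
      rw [Finset.sum_range_succ, ih]
      simp only [g, LinearMap.sub_apply, LinearMap.comp_apply, Submodule.subtype_apply,
        vectorSeriesLinear_apply]
      ring

/-- Reduces normality to the unit ball, where compactness is available. -/
theorem IsBallContinuous.isNormalFunctional {f : M →ₗ[ℂ] ℂ}
    (hf : IsBallContinuous f) {C : ℝ} (hC : ∀ x, ‖f x‖ ≤ C * ‖(x : H →L[ℂ] H)‖) :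
    IsNormalFunctional f := by
  obtain ⟨ξ, η, h⟩ := hf.exists_eq_vectorSeriesFunctional hC
  rw [show f = vectorSeriesLinear ξ η ∘ₗ M.toSubmodule.subtype from LinearMap.ext h]
  exact isNormalFunctional_vectorSeries ξ η

end DualOperatorSystem

/-! ### Order, norm and self-adjoint parts -/

section Order

variable {H : Type*} [NormedAddCommGroup H] [InnerProductSpace ℂ H] [CompleteSpace H]

/-- The order and the unit determine the norm of self-adjoint operators, which links positivity with
contractivity. For the converse, `c - T` and `c + T` are commuting positive operators, so their
product `c² - T*T` is positive and the C*-identity applies. -/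
theorem norm_le_iff_of_isSelfAdjoint {T : H →L[ℂ] H} (hT : IsSelfAdjoint T) {c : ℝ} (hc : 0 ≤ c) :
    ‖T‖ ≤ c ↔ 0 ≤ (c : ℂ) • (1 : H →L[ℂ] H) - T ∧ 0 ≤ (c : ℂ) • (1 : H →L[ℂ] H) + T := by
  have hcsmul : ∀ a : ℝ, algebraMap ℝ (H →L[ℂ] H) a = (a : ℂ) • (1 : H →L[ℂ] H) := fun a => by
    rw [Algebra.algebraMap_eq_smul_one, Complex.coe_smul]
  constructor
  · intro h
    have hle : algebraMap ℝ (H →L[ℂ] H) ‖T‖ ≤ algebraMap ℝ (H →L[ℂ] H) c :=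
      algebraMap_mono _ h
    rw [← hcsmul]
    refine ⟨sub_nonneg.2 (hT.le_algebraMap_norm_self.trans hle), ?_⟩
    rw [← neg_le_iff_add_nonneg']
    have h1 := hT.neg_algebraMap_norm_le_self
    exact (neg_le_neg hle).trans h1
  · rintro ⟨h1, h2⟩
    have hcomm : Commute ((c : ℂ) • (1 : H →L[ℂ] H) - T) ((c : ℂ) • (1 : H →L[ℂ] H) + T) :=
      ((Commute.one_left _).smul_left _).sub_left
        (((Commute.one_right _).smul_right _).add_right (Commute.refl T))
    have h3 := Commute.mul_nonneg h1 h2 hcomm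
    have h4 : ((c : ℂ) • (1 : H →L[ℂ] H) - T) * ((c : ℂ) • (1 : H →L[ℂ] H) + T) =
        algebraMap ℝ (H →L[ℂ] H) (c ^ 2) - star T * T := by
      rw [hT.star_eq, hcsmul]
      simp only [sub_mul, mul_add, smul_mul_assoc, mul_smul_comm, one_mul, mul_one, sq]
      push_cast
      module
    rw [h4, sub_nonneg] at h3
    have h5 := (CStarAlgebra.norm_le_iff_le_algebraMap (star T * T) (sq_nonneg c)
      (star_mul_self_nonneg T)).2 h3
    rw [CStarRing.norm_star_mul_self, ← sq] at h5
    exact le_of_sq_le_sq h5 hc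

end Order

namespace DualOperatorSystem

variable {H : Type*} [NormedAddCommGroup H] [InnerProductSpace ℂ H] [CompleteSpace H]
  {M : DualOperatorSystem H}

@[simp] theorem coe_unit : ((M.unit : M) : H →L[ℂ] H) = 1 := rfl

/-- The adjoint of an element of a dual operator system. -/
noncomputable def adj (x : M) : M := ⟨star (x : H →L[ℂ] H), M.star_mem' _ x.2⟩

@[simp] theorem coe_adj (x : M) : (adj x : H →L[ℂ] H) = star (x : H →L[ℂ] H) := rfl

theorem exists_selfAdjoint_decomposition (x : M) : ∃ a b : M,
    (IsSelfAdjoint (a : H →L[ℂ] H) ∧ ‖(a : H →L[ℂ] H)‖ ≤ ‖(x : H →L[ℂ] H)‖) ∧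
    (IsSelfAdjoint (b : H →L[ℂ] H) ∧ ‖(b : H →L[ℂ] H)‖ ≤ ‖(x : H →L[ℂ] H)‖) ∧
    x = a + Complex.I • b := by
  -- The real and imaginary parts are the cases `c = 1` and `c = -i`.
  have key : ∀ c : ℂ, ‖c‖ = 1 →
      ‖(2⁻¹ : ℂ) • (c • (x : H →L[ℂ] H) + star (c • (x : H →L[ℂ] H)))‖ ≤ ‖(x : H →L[ℂ] H)‖ := by
    intro c hc
    have h1 := norm_add_le (c • (x : H →L[ℂ] H)) (star (c • (x : H →L[ℂ] H)))
    rw [norm_star, norm_smul, hc, one_mul] at h1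
    rw [norm_smul, norm_inv, Complex.norm_ofNat]
    linarith
  have hsa : ∀ T : H →L[ℂ] H, IsSelfAdjoint ((2⁻¹ : ℂ) • (T + star T)) := fun T => by
    rw [isSelfAdjoint_iff, star_smul, star_add, star_star, add_comm]
    simp
  refine ⟨(2⁻¹ : ℂ) • (x + adj x), (2⁻¹ : ℂ) • (-Complex.I • x + adj (-Complex.I • x)),
    ⟨hsa _, ?_⟩, ⟨hsa _, ?_⟩, ?_⟩
  · simpa using key 1 (by simp)
  · exact key (-Complex.I) (by simp)
  · refine Subtype.ext ?_
    simp only [Submodule.coe_add, Submodule.coe_smul, coe_adj, star_smul, smul_add, smul_smul]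
    rw [show star (-Complex.I) = Complex.I by simp]
    have e1 : Complex.I * (2⁻¹ * -Complex.I) = 2⁻¹ := by
      linear_combination (-2⁻¹ : ℂ) * Complex.I_mul_I
    have e2 : Complex.I * 2⁻¹ * Complex.I = -2⁻¹ := by
      linear_combination (2⁻¹ : ℂ) * Complex.I_mul_I
    rw [e1, e2]
    module

end DualOperatorSystem

open DualOperatorSystem

/-! ### UP maps and UP-isomorphisms -/

namespace UPMap

variable {H K : Type*} [NormedAddCommGroup H] [InnerProductSpace ℂ H] [CompleteSpace H]
  [NormedAddCommGroup K] [InnerProductSpace ℂ K] [CompleteSpace K]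
  {M : DualOperatorSystem H} {N : DualOperatorSystem K} (φ : UPMap M N)

theorem map_unit : φ M.unit = N.unit := φ.map_unit'

theorem map_nonneg {x : M} (hx : 0 ≤ (x : H →L[ℂ] H)) : 0 ≤ (φ x : K →L[ℂ] K) :=
  φ.map_nonneg' x hx

theorem tendsto {ι : Type*} {l : Filter ι} {x : ι → M} {z : M}
    (h : Tendsto x l (@nhds _ M.weakStar z)) :
    Tendsto (fun i => φ (x i)) l (@nhds _ N.weakStar (φ z)) :=
  Tendsto.comp (@Continuous.tendsto _ _ M.weakStar N.weakStar _ φ.normal' z) h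

/-- A UP map carries `‖x‖·1 ± x ≥ 0` to `‖x‖·1 ± φ(x) ≥ 0`. -/
theorem isSelfAdjoint_and_norm_le {x : M} (hx : IsSelfAdjoint (x : H →L[ℂ] H)) :
    IsSelfAdjoint (φ x : K →L[ℂ] K) ∧ ‖(φ x : K →L[ℂ] K)‖ ≤ ‖(x : H →L[ℂ] H)‖ := by
  set c := ‖(x : H →L[ℂ] H)‖ with hc
  obtain ⟨h1, h2⟩ := (norm_le_iff_of_isSelfAdjoint hx (norm_nonneg _)).1 hc.ge
  have h3 := φ.map_nonneg (x := (c : ℂ) • M.unit - x) h1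
  have h4 := φ.map_nonneg (x := (c : ℂ) • M.unit + x) h2
  simp only [map_sub, map_add, map_smul, φ.map_unit, Submodule.coe_sub, Submodule.coe_add,
    Submodule.coe_smul, coe_unit] at h3 h4
  have hsa : IsSelfAdjoint (φ x : K →L[ℂ] K) := by
    have h5 : IsSelfAdjoint ((c : ℂ) • (1 : K →L[ℂ] K)) := by
      rw [isSelfAdjoint_iff, star_smul, star_one, RCLike.star_def, Complex.conj_ofReal]
    simpa using (IsSelfAdjoint.of_nonneg h4).sub h5
  exact ⟨hsa, (norm_le_iff_of_isSelfAdjoint hsa (norm_nonneg _)).2 ⟨h3, h4⟩⟩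

theorem isSelfAdjoint {x : M} (hx : IsSelfAdjoint (x : H →L[ℂ] H)) :
    IsSelfAdjoint (φ x : K →L[ℂ] K) := (φ.isSelfAdjoint_and_norm_le hx).1

theorem map_adj (x : M) : φ (adj x) = adj (φ x) := by
  obtain ⟨a, b, ⟨ha, -⟩, ⟨hb, -⟩, rfl⟩ := exists_selfAdjoint_decomposition x
  have h1 : adj (a + Complex.I • b) = a - Complex.I • b := Subtype.ext (by
    simp [ha.star_eq, hb.star_eq, sub_eq_add_neg])
  rw [h1]
  refine Subtype.ext ?_
  simp [(φ.isSelfAdjoint ha).star_eq, (φ.isSelfAdjoint hb).star_eq, sub_eq_add_neg]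

/-- A unital linear map which preserves self-adjointness and is contractive on self-adjoint elements
is positive. -/
theorem nonneg_of_contractive {θ : M →ₗ[ℂ] N} (hunit : θ M.unit = N.unit)
    (hθ : ∀ x : M, IsSelfAdjoint (x : H →L[ℂ] H) →
      IsSelfAdjoint (θ x : K →L[ℂ] K) ∧ ‖(θ x : K →L[ℂ] K)‖ ≤ ‖(x : H →L[ℂ] H)‖)
    (x : M) (hx : 0 ≤ (x : H →L[ℂ] H)) : 0 ≤ (θ x : K →L[ℂ] K) := by
  have hsa := IsSelfAdjoint.of_nonneg hx
  set c := ‖(x : H →L[ℂ] H)‖ with hc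
  have hc0 : 0 ≤ c := norm_nonneg _
  have h5 : IsSelfAdjoint ((c : ℂ) • (1 : H →L[ℂ] H)) := by
    rw [isSelfAdjoint_iff, star_smul, star_one, RCLike.star_def, Complex.conj_ofReal]
  obtain ⟨h1, -⟩ := (norm_le_iff_of_isSelfAdjoint hsa hc0).1 hc.ge
  -- From `0 ≤ x ≤ c·1` the element `c·1 - x` has norm at most `c`; hence so does `c·1 - θ(x)`,
  -- which forces `θ(x) ≥ 0`.
  have h2 : IsSelfAdjoint (((c : ℂ) • M.unit - x : M) : H →L[ℂ] H) := h5.sub hsa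
  have h3 : ‖(((c : ℂ) • M.unit - x : M) : H →L[ℂ] H)‖ ≤ c := by
    refine (norm_le_iff_of_isSelfAdjoint h2 hc0).2 ⟨?_, ?_⟩
    · simpa using hx
    · have h6 : 0 ≤ (c : ℂ) • (1 : H →L[ℂ] H) := by
        rw [Complex.coe_smul]
        exact smul_nonneg hc0 zero_le_one
      exact add_nonneg h6 h1
  obtain ⟨h7, h8⟩ := hθ _ h2
  have h9 := ((norm_le_iff_of_isSelfAdjoint h7 hc0).1 (h8.trans h3)).1
  simpa [hunit] using h9

end UPMap

namespace UPIso

variable {H K : Type*} [NormedAddCommGroup H] [InnerProductSpace ℂ H] [CompleteSpace H]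
  [NormedAddCommGroup K] [InnerProductSpace ℂ K] [CompleteSpace K]
  {M : DualOperatorSystem H} {N : DualOperatorSystem K}

/-- The UP map underlying a UP-isomorphism. -/
def toUPMap (θ : UPIso M N) : UPMap M N where
  toLinearMap := θ.toLinearEquiv
  map_unit' := θ.map_unit'
  map_nonneg' := θ.map_nonneg'
  normal' := θ.normal'

/-- The inverse of a UP-isomorphism, as a UP map. -/
def invUPMap (θ : UPIso M N) : UPMap N M where
  toLinearMap := θ.toLinearEquiv.symm
  map_unit' := by
    have h : θ.toLinearEquiv M.unit = N.unit := θ.map_unit'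
    exact (θ.toLinearEquiv.symm_apply_eq).2 h.symm
  map_nonneg' := θ.inv_nonneg'
  normal' := θ.inv_normal'

theorem ext' {θ θ' : UPIso M N} (h : ∀ x, θ x = θ' x) : θ = θ' := by
  have : θ.toLinearEquiv = θ'.toLinearEquiv := LinearEquiv.ext h
  cases θ
  cases θ'
  congr

/-- Two mutually inverse UP maps form a UP-isomorphism. -/
def ofInverse (θ : UPMap M N) (θ' : UPMap N M) (h : ∀ x, θ' (θ x) = x) (h' : ∀ y, θ (θ' y) = y) :
    UPIso M N where
  toLinearEquiv := LinearEquiv.ofLinearMap θ.toLinearMap θ'.toLinearMap (LinearMap.ext h')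
    (LinearMap.ext h)
  map_unit' := θ.map_unit'
  map_nonneg' := θ.map_nonneg'
  inv_nonneg' := θ'.map_nonneg'
  normal' := θ.normal'
  inv_normal' := θ'.normal'

end UPIso

/-! ### Diagonal entries of operators on `ℓ²` -/

section Coordinates

variable {ι : Type*} [DecidableEq ι] {H : Type*} [NormedAddCommGroup H] [InnerProductSpace ℂ H]

/-- The inclusion of a coordinate into an `ℓ²` space. -/
noncomputable def lpInclusion (i : ι) : H →L[ℂ] lp (fun _ : ι => H) 2 :=
  LinearMap.mkContinuous
    { toFun := fun v => lp.single 2 i v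
      map_add' := fun v w => lp.single_add (E := fun _ : ι => H) 2 i v w
      map_smul' := fun c v => lp.single_smul (E := fun _ : ι => H) 2 i c v }
    1 fun v => by
      rw [one_mul]
      exact (lp.norm_single (E := fun _ : ι => H) (p := 2) (by norm_num) i v).le

omit [DecidableEq ι] in
/-- The projection of an `ℓ²` space onto a coordinate. -/
noncomputable def lpProjection (i : ι) : lp (fun _ : ι => H) 2 →L[ℂ] H :=
  LinearMap.mkContinuous
    { toFun := fun ξ => ξ i
      map_add' := fun _ _ => rfl
      map_smul' := fun _ _ => rfl }
    1 fun ξ => by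
      rw [one_mul]
      exact lp.norm_apply_le_norm (by norm_num) ξ i

/-- The diagonal entry of an operator on an `ℓ²` space. -/
noncomputable def lpEntry (i : ι) (T : lp (fun _ : ι => H) 2 →L[ℂ] lp (fun _ : ι => H) 2) :
    H →L[ℂ] H :=
  lpProjection i ∘L T ∘L lpInclusion i

theorem lpEntry_apply (i : ι) (T : lp (fun _ : ι => H) 2 →L[ℂ] lp (fun _ : ι => H) 2) (v : H) :
    lpEntry i T v = T (lp.single 2 i v) i := rfl

theorem norm_lpEntry_le (i : ι) (T : lp (fun _ : ι => H) 2 →L[ℂ] lp (fun _ : ι => H) 2) :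
    ‖lpEntry i T‖ ≤ ‖T‖ := by
  refine ContinuousLinearMap.opNorm_le_bound _ (norm_nonneg T) fun v => ?_
  rw [lpEntry_apply]
  refine (lp.norm_apply_le_norm (by norm_num) _ i).trans ((T.le_opNorm _).trans_eq ?_)
  rw [lp.norm_single (by norm_num)]

theorem inner_lpEntry (i : ι) (T : lp (fun _ : ι => H) 2 →L[ℂ] lp (fun _ : ι => H) 2) (v w : H) :
    (inner ℂ v (lpEntry i T w) : ℂ) = inner ℂ (lp.single 2 i v) (T (lp.single 2 i w)) := by
  rw [lpEntry_apply, lp.inner_single_left]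

theorem lpEntry_isSelfAdjoint [CompleteSpace H] {i : ι}
    {T : lp (fun _ : ι => H) 2 →L[ℂ] lp (fun _ : ι => H) 2} (hT : IsSelfAdjoint T) :
    IsSelfAdjoint (lpEntry i T) := by
  rw [ContinuousLinearMap.isSelfAdjoint_iff_isSymmetric] at hT ⊢
  intro v w
  change inner ℂ (lpEntry i T v) w = (inner ℂ v (lpEntry i T w) : ℂ)
  rw [inner_lpEntry, ← inner_conj_symm, inner_lpEntry, inner_conj_symm]
  exact hT _ _

theorem lpEntry_nonneg [CompleteSpace H] {i : ι}
    {T : lp (fun _ : ι => H) 2 →L[ℂ] lp (fun _ : ι => H) 2} (hT : 0 ≤ T) : 0 ≤ lpEntry i T := by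
  rw [ContinuousLinearMap.nonneg_iff_isPositive, ContinuousLinearMap.isPositive_def'] at hT ⊢
  refine ⟨lpEntry_isSelfAdjoint hT.1, fun v => ?_⟩
  have := hT.2 (lp.single 2 i v)
  rw [ContinuousLinearMap.reApplyInnerSelf_apply, ← inner_re_symm] at this ⊢
  rwa [inner_lpEntry]

end Coordinates

namespace UPMap

variable {H K : Type*} [NormedAddCommGroup H] [InnerProductSpace ℂ H] [CompleteSpace H]
  [NormedAddCommGroup K] [InnerProductSpace ℂ K] [CompleteSpace K]
  {M : DualOperatorSystem H} {N : DualOperatorSystem K}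

theorem continuous_of_tendsto {f : M → N} (h : ∀ z : M,
    Tendsto (fun x => (f x : K →L[ℂ] K)) (@nhds _ M.weakStar z)
      (@nhds _ (ultraweakTopology K) (f z))) : Continuous[M.weakStar, N.weakStar] f :=
  (@continuous_iff_continuousAt _ _ M.weakStar N.weakStar _).2 fun z => tendsto_weakStar_iff.2 (h z)

/-- The iterates of a UP map are UP maps. -/
noncomputable def iterate (φ : UPMap M M) (k : ℕ) : UPMap M M where
  toLinearMap := φ.toLinearMap ^ k
  map_unit' := by
    change (φ.toLinearMap ^ k) M.unit = M.unit
    induction k with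
    | zero => rfl
    | succ k ih =>
      rw [pow_succ', Module.End.mul_apply, ih]
      exact φ.map_unit
  map_nonneg' x hx := by
    change 0 ≤ ((φ.toLinearMap ^ k) x : H →L[ℂ] H)
    induction k with
    | zero => exact hx
    | succ k ih =>
      rw [pow_succ', Module.End.mul_apply]
      exact φ.map_nonneg ih
  normal' := continuous_of_tendsto fun z => by
    rw [← tendsto_weakStar_iff]
    change Tendsto (fun x => (φ.toLinearMap ^ k) x) _ (@nhds _ M.weakStar ((φ.toLinearMap ^ k) z))
    induction k with
    | zero => exact tendsto_id
    | succ k ih =>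
      simp only [pow_succ', Module.End.mul_apply]
      exact φ.tendsto ih

theorem iterate_succ (φ : UPMap M M) (k : ℕ) (x : M) :
    φ.iterate (k + 1) x = φ (φ.iterate k x) := by
  change (φ.toLinearMap ^ (k + 1)) x = φ.toLinearMap ((φ.toLinearMap ^ k) x)
  rw [pow_succ', Module.End.mul_apply]

theorem iterate_succ' (φ : UPMap M M) (k : ℕ) (x : M) :
    φ.iterate (k + 1) x = φ.iterate k (φ x) := by
  change (φ.toLinearMap ^ (k + 1)) x = (φ.toLinearMap ^ k) (φ.toLinearMap x)
  rw [pow_succ, Module.End.mul_apply]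

end UPMap

/-! ### Inverse sequences and diagonal operators -/

namespace IsInverseSequence

variable {H : Type*} [NormedAddCommGroup H] [InnerProductSpace ℂ H] [CompleteSpace H]
  {M : DualOperatorSystem H} {φ : UPMap M M} {x y : ℤ → M}

theorem eq_iterate (hx : IsInverseSequence φ x) (k : ℕ) (n : ℤ) :
    x n = φ.iterate k (x (n + k)) := by
  induction k with
  | zero => simp [UPMap.iterate]
  | succ k ih =>
    rw [ih, UPMap.iterate_succ', hx.2 (n + k)]
    push_cast
    rw [add_assoc]

theorem add (hx : IsInverseSequence φ x) (hy : IsInverseSequence φ y) :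
    IsInverseSequence φ (x + y) := by
  obtain ⟨⟨C, hC⟩, hx⟩ := hx
  obtain ⟨⟨D, hD⟩, hy⟩ := hy
  refine ⟨⟨C + D, fun n => (norm_add_le _ _).trans (add_le_add (hC n) (hD n))⟩, fun n => ?_⟩
  simp only [Pi.add_apply, map_add]
  rw [← hx, ← hy]

theorem smul (c : ℂ) (hx : IsInverseSequence φ x) : IsInverseSequence φ (c • x) := by
  obtain ⟨⟨C, hC⟩, hx⟩ := hx
  refine ⟨⟨‖c‖ * C, fun n => (norm_smul_le _ _).trans ?_⟩, fun n => ?_⟩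
  · gcongr
    exact hC n
  · simp only [Pi.smul_apply, map_smul]
    rw [← hx]

theorem unit (φ : UPMap M M) : IsInverseSequence φ fun _ => M.unit :=
  ⟨⟨_, fun _ => le_rfl⟩, fun _ => φ.map_unit.symm⟩

theorem adj (hx : IsInverseSequence φ x) :
    IsInverseSequence φ fun n => DualOperatorSystem.adj (x n) := by
  obtain ⟨⟨C, hC⟩, hx⟩ := hx
  refine ⟨⟨C, fun n => ?_⟩, fun n => ?_⟩
  · rw [coe_adj, norm_star]
    exact hC n
  · rw [φ.map_adj, ← hx]

theorem shift (hx : IsInverseSequence φ x) (k : ℤ) : IsInverseSequence φ fun n => x (n + k) := by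
  obtain ⟨⟨C, hC⟩, hx⟩ := hx
  refine ⟨⟨C, fun n => hC _⟩, fun n => ?_⟩
  have := hx (n + k)
  rwa [add_right_comm] at this

end IsInverseSequence

namespace IsDiagonalOf

variable {H : Type*} [NormedAddCommGroup H] [InnerProductSpace ℂ H] [CompleteSpace H]
  {M : DualOperatorSystem H} {S T : lp (fun _ : ℤ => H) 2 →L[ℂ] lp (fun _ : ℤ => H) 2}
  {x y : ℤ → M}

theorem lpEntry_eq (h : IsDiagonalOf T x) (n : ℤ) : lpEntry n T = x n := by
  ext v
  rw [lpEntry_apply, h, lp.single_apply_self]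

theorem add (hS : IsDiagonalOf S x) (hT : IsDiagonalOf T y) : IsDiagonalOf (S + T) (x + y) :=
  fun ξ n => congrArg₂ (· + ·) (hS ξ n) (hT ξ n)

theorem smul (c : ℂ) (hT : IsDiagonalOf T x) : IsDiagonalOf (c • T) (c • x) :=
  fun ξ n => congrArg (c • ·) (hT ξ n)

theorem adj (hT : IsDiagonalOf T x) :
    IsDiagonalOf (star T) fun n => DualOperatorSystem.adj (x n) := fun ξ n => by
  refine ext_inner_left (E := H) ℂ fun v => ?_
  refine (lp.inner_single_left (𝕜 := ℂ) (G := fun _ : ℤ => H) n v (star T ξ)).symm.trans ?_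
  rw [ContinuousLinearMap.star_eq_adjoint,
    ContinuousLinearMap.adjoint_inner_right, coe_adj, ContinuousLinearMap.star_eq_adjoint,
    ContinuousLinearMap.adjoint_inner_right]
  have h : T (lp.single 2 n v) = lp.single 2 n ((x n : H →L[ℂ] H) v) := by
    ext m
    rw [hT]
    rcases eq_or_ne m n with rfl | hmn
    · simp
    · simp [Pi.single_eq_of_ne hmn]
  rw [h, lp.inner_single_left]

theorem op_eq (hS : IsDiagonalOf S x) (hT : IsDiagonalOf T x) : S = T := by
  ext ξ n
  rw [hS, hT]

theorem seq_eq (h : IsDiagonalOf T x) (h' : IsDiagonalOf T y) : x = y :=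
  funext fun n => Subtype.ext ((h.lpEntry_eq n).symm.trans (h'.lpEntry_eq n))

theorem isSelfAdjoint (hT : IsDiagonalOf T x) (hx : ∀ n, IsSelfAdjoint (x n : H →L[ℂ] H)) :
    IsSelfAdjoint T := by
  refine hT.adj.op_eq ?_
  rwa [show (fun n => DualOperatorSystem.adj (x n)) = x from funext fun n => Subtype.ext (hx n)]

theorem nonneg (hT : IsDiagonalOf T x) (hx : ∀ n, 0 ≤ (x n : H →L[ℂ] H)) : 0 ≤ T := by
  rw [ContinuousLinearMap.nonneg_iff_isPositive, ContinuousLinearMap.isPositive_def']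
  refine ⟨hT.isSelfAdjoint fun n => .of_nonneg (hx n), fun ξ => ?_⟩
  rw [ContinuousLinearMap.reApplyInnerSelf_apply, lp.inner_eq_tsum,
    RCLike.re_tsum _ (lp.summable_inner _ _)]
  refine tsum_nonneg fun n => ?_
  rw [hT]
  have := (ContinuousLinearMap.nonneg_iff_isPositive _).1 (hx n)
  exact this.re_inner_nonneg_left _

theorem isDiagonalOf_lpDiagonal (x : ℤ → M) (C : ℝ) (hC : ∀ n, ‖(x n : H →L[ℂ] H)‖ ≤ C) :
    IsDiagonalOf (lpDiagonal (fun n => (x n : H →L[ℂ] H)) C hC) x := fun _ _ => rfl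

end IsDiagonalOf

/-! ### The lift on inverse sequences -/

section InverseSystem

variable {H : Type*} [NormedAddCommGroup H] [InnerProductSpace ℂ H] [CompleteSpace H]
  {M : DualOperatorSystem H} (φ : UPMap M M)

theorem tendsto_lpEntry {ι : Type*} {l : Filter ι}
    {T : ι → lp (fun _ : ℤ => H) 2 →L[ℂ] lp (fun _ : ℤ => H) 2}
    {S : lp (fun _ : ℤ => H) 2 →L[ℂ] lp (fun _ : ℤ => H) 2}
    (h : Tendsto T l (@nhds _ (ultraweakTopology _) S)) (n : ℤ) :
    Tendsto (fun i => lpEntry n (T i)) l (@nhds _ (ultraweakTopology H) (lpEntry n S)) := by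
  simp only [lpEntry]
  exact tendsto_ultraweak_conj (lpProjection n) (lpInclusion n) h

/-- This is the weak-star closedness of the space of inverse sequences. Diagonal entries converge
and stay in `M`, normality of `φ` preserves the recursion, and the limit operator itself supplies
the bound on the entries. -/
theorem exists_isInverseSequence_of_tendsto {ι : Type*} {l : Filter ι} [l.NeBot]
    {T : ι → lp (fun _ : ℤ => H) 2 →L[ℂ] lp (fun _ : ℤ => H) 2}
    {S : lp (fun _ : ℤ => H) 2 →L[ℂ] lp (fun _ : ℤ => H) 2}
    (hT : ∀ i, ∃ x : ℤ → M, IsInverseSequence φ x ∧ IsDiagonalOf (T i) x)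
    (h : Tendsto T l (@nhds _ (ultraweakTopology _) S)) :
    ∃ x : ℤ → M, IsInverseSequence φ x ∧ IsDiagonalOf S x := by
  choose x hx hxT using hT
  have hlim : ∀ n, Tendsto (fun i => (x i n : H →L[ℂ] H)) l
      (@nhds _ (ultraweakTopology H) (lpEntry n S)) := fun n => by
    simpa only [(hxT _).lpEntry_eq] using tendsto_lpEntry h n
  let y : ℤ → M := fun n => ⟨lpEntry n S, mem_of_tendsto_ultraweak (hlim n)⟩
  have hlim' : ∀ n, Tendsto (fun i => x i n) l (@nhds _ M.weakStar (y n)) := fun n =>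
    tendsto_weakStar_iff.2 (hlim n)
  refine ⟨y, ⟨⟨‖S‖, fun n => norm_lpEntry_le n S⟩, fun n => ?_⟩, fun ξ n => ?_⟩
  · refine tendsto_weakStar_unique (hlim' n) ?_
    simpa only [← (hx _).2] using φ.tendsto (hlim' (n + 1))
  · refine ext_inner_left (E := H) ℂ fun v => ?_
    refine (lp.inner_single_left (𝕜 := ℂ) (G := fun _ : ℤ => H) n v (S ξ)).symm.trans ?_
    refine tendsto_nhds_unique (tendsto_inner_of_tendsto_ultraweak h _ _) ?_
    simpa only [lp.inner_single_left, (hxT _) ξ n] using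
      tendsto_inner_of_tendsto_ultraweak (hlim n) v (ξ n)

/-- The dual operator system of all inverse sequences of a UP map. -/
noncomputable def inverseSystem : DualOperatorSystem (lp (fun _ : ℤ => H) 2) where
  carrier := {T | ∃ x : ℤ → M, IsInverseSequence φ x ∧ IsDiagonalOf T x}
  add_mem' := fun ⟨_, hx, hS⟩ ⟨_, hy, hT⟩ => ⟨_, hx.add hy, hS.add hT⟩
  zero_mem' := ⟨0, ⟨⟨0, fun _ => norm_zero.le⟩, fun _ => (map_zero φ.toLinearMap).symm⟩,
    fun _ _ => rfl⟩
  smul_mem' := fun c _ ⟨_, hx, hT⟩ => ⟨_, hx.smul c, hT.smul c⟩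
  one_mem' := ⟨_, IsInverseSequence.unit φ, fun _ _ => rfl⟩
  star_mem' := fun _ ⟨_, hx, hT⟩ => ⟨_, hx.adj, hT.adj⟩
  isClosed' := by
    let _ := ultraweakTopology (lp (fun _ : ℤ => H) 2)
    refine isClosed_of_closure_subset fun S hS => ?_
    have := mem_closure_iff_comap_neBot.1 hS
    exact exists_isInverseSequence_of_tendsto φ (fun T : {T | ∃ x : ℤ → M, IsInverseSequence φ x ∧ IsDiagonalOf T x} => T.2) tendsto_comap

theorem mem_inverseSystem {T : lp (fun _ : ℤ => H) 2 →L[ℂ] lp (fun _ : ℤ => H) 2} :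
    T ∈ (inverseSystem φ).toSubmodule ↔
      ∃ x : ℤ → M, IsInverseSequence φ x ∧ IsDiagonalOf T x := Iff.rfl

variable {φ}

/-- The inverse sequence of an element of `inverseSystem φ`. -/
noncomputable def inverseSeq (T : inverseSystem φ) : ℤ → M := ((mem_inverseSystem φ).1 T.2).choose

theorem isInverseSequence_inverseSeq (T : inverseSystem φ) :
    IsInverseSequence φ (inverseSeq T) := ((mem_inverseSystem φ).1 T.2).choose_spec.1

theorem isDiagonalOf_inverseSeq (T : inverseSystem φ) : IsDiagonalOf T.1 (inverseSeq T) :=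
  ((mem_inverseSystem φ).1 T.2).choose_spec.2

/-- Removes the arbitrariness of the choice in `inverseSeq`: positivity, norm bounds and continuity
are inherited from the compression `lpEntry`. -/
theorem coe_inverseSeq (T : inverseSystem φ) (n : ℤ) :
    (inverseSeq T n : H →L[ℂ] H) = lpEntry n T.1 :=
  ((isDiagonalOf_inverseSeq T).lpEntry_eq n).symm

variable (φ)

/-- Evaluation of inverse sequences at `0`. -/
noncomputable def inverseEval : UPMap (inverseSystem φ) M where
  toFun T := inverseSeq T 0
  map_add' S T := congrFun ((isDiagonalOf_inverseSeq (S + T)).seq_eq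
    ((isDiagonalOf_inverseSeq S).add (isDiagonalOf_inverseSeq T))) 0
  map_smul' c T := congrFun ((isDiagonalOf_inverseSeq (c • T)).seq_eq
    ((isDiagonalOf_inverseSeq T).smul c)) 0
  map_unit' := congrFun ((isDiagonalOf_inverseSeq (inverseSystem φ).unit).seq_eq
    (y := fun _ => M.unit) fun _ _ => rfl) 0
  map_nonneg' T hT := by
    rw [coe_inverseSeq]
    exact lpEntry_nonneg hT
  normal' := UPMap.continuous_of_tendsto fun z => by
    change Tendsto (fun T : inverseSystem φ => (inverseSeq T 0 : H →L[ℂ] H)) _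
      (@nhds _ (ultraweakTopology H) (inverseSeq z 0 : H →L[ℂ] H))
    simp only [coe_inverseSeq]
    exact tendsto_lpEntry (tendsto_weakStar_iff.1 tendsto_id) 0

theorem inverseEval_apply (T : inverseSystem φ) : inverseEval φ T = inverseSeq T 0 := rfl

theorem isDiagonalOf_shift {T : lp (fun _ : ℤ => H) 2 →L[ℂ] lp (fun _ : ℤ => H) 2} {x : ℤ → M}
    (hT : IsDiagonalOf T x) (k : ℤ) :
    IsDiagonalOf (lpReindex (Equiv.addRight k) ∘L T ∘L lpReindex (Equiv.addRight k).symm)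
      fun n => x (n + k) := fun ξ n => by
  simp only [ContinuousLinearMap.comp_apply, lpReindex_apply]
  rw [hT, lpReindex_apply, Equiv.symm_apply_apply, Equiv.coe_addRight]

/-- The translation of inverse sequences by `k` places. -/
noncomputable def inverseShift (k : ℤ) : UPMap (inverseSystem φ) (inverseSystem φ) where
  toFun T := ⟨lpReindex (Equiv.addRight k) ∘L T.1 ∘L lpReindex (Equiv.addRight k).symm,
    _, (isInverseSequence_inverseSeq T).shift k, isDiagonalOf_shift (isDiagonalOf_inverseSeq T) k⟩
  map_add' S T := by
    refine Subtype.ext ?_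
    simp [ContinuousLinearMap.comp_add, ContinuousLinearMap.add_comp]
  map_smul' c T := by
    refine Subtype.ext ?_
    simp [ContinuousLinearMap.smul_comp]
  map_unit' := by
    refine Subtype.ext ?_
    ext ξ n
    simp [ContinuousLinearMap.comp_apply]
  map_nonneg' T hT := by
    refine (isDiagonalOf_shift (isDiagonalOf_inverseSeq T) k).nonneg fun n => ?_
    rw [coe_inverseSeq]
    exact lpEntry_nonneg hT
  normal' := UPMap.continuous_of_tendsto fun z =>
    tendsto_ultraweak_conj _ _ (tendsto_weakStar_iff.1 tendsto_id)

theorem inverseShift_isDiagonalOf {T : inverseSystem φ} {x : ℤ → M} (hT : IsDiagonalOf T.1 x)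
    (k : ℤ) : IsDiagonalOf (inverseShift φ k T).1 fun n => x (n + k) :=
  isDiagonalOf_shift hT k

theorem inverseSeq_inverseShift (T : inverseSystem φ) (k n : ℤ) :
    inverseSeq (inverseShift φ k T) n = inverseSeq T (n + k) :=
  congrFun ((isDiagonalOf_inverseSeq _).seq_eq
    (inverseShift_isDiagonalOf φ (isDiagonalOf_inverseSeq T) k)) n

variable {φ} in
theorem inverseSystem_ext {S T : inverseSystem φ} (h : ∀ n, inverseSeq S n = inverseSeq T n) :
    S = T := by
  refine Subtype.ext ((isDiagonalOf_inverseSeq S).op_eq ?_)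
  rw [funext h]
  exact isDiagonalOf_inverseSeq T

/-- The bilateral shift on the space of inverse sequences. -/
noncomputable def inverseAut : UPIso (inverseSystem φ) (inverseSystem φ) :=
  UPIso.ofInverse (inverseShift φ (-1)) (inverseShift φ 1)
    (fun T => inverseSystem_ext fun n => by simp [inverseSeq_inverseShift])
    (fun T => inverseSystem_ext fun n => by simp [inverseSeq_inverseShift])

theorem inverseSeq_inverseAut_symm_iterate (T : inverseSystem φ) (k : ℕ) (n : ℤ) :
    inverseSeq ((inverseAut φ).toLinearEquiv.symm^[k] T) n = inverseSeq T (n + k) := by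
  induction k generalizing n with
  | zero => simp
  | succ k ih =>
    rw [Function.iterate_succ_apply']
    refine (inverseSeq_inverseShift φ _ 1 n).trans ?_
    rw [ih]
    push_cast
    ring_nf

/-- Both sides are the coordinate `x₋₁ = φ(x₀)`. -/
theorem isReversibleLift_inverseAut : IsReversibleLift φ (inverseAut φ) (inverseEval φ) :=
  fun T => by
    refine (inverseSeq_inverseShift φ T (-1) 0).trans ?_
    rw [(isInverseSequence_inverseSeq T).2]
    rfl

theorem isNondegenerateLift_inverseAut : IsNondegenerateLift (inverseAut φ) (inverseEval φ) := by
  intro T hT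
  have h0 : ∀ k : ℕ, inverseSeq T k = 0 := fun k => by
    rw [← hT k, inverseEval_apply, inverseSeq_inverseAut_symm_iterate, zero_add]
  refine Subtype.ext ((isDiagonalOf_inverseSeq T).op_eq fun ξ n => ?_)
  have : inverseSeq T n = 0 := by
    -- The hypothesis kills the coordinates with index at least `0`; every other one is an iterated
    -- image of such a coordinate, since `n + |n| ≥ 0`.
    rw [(isInverseSequence_inverseSeq T).eq_iterate n.natAbs n]
    obtain ⟨k, hk⟩ := Int.eq_ofNat_of_zero_le (show 0 ≤ n + n.natAbs by omega)
    rw [hk, h0, map_zero]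
  rw [this]
  rfl

theorem enorm_le_saNorm {ρ : M →ₗ[ℂ] ℂ} {x : M} (hx : IsSelfAdjoint (x : H →L[ℂ] H))
    (hx' : ‖(x : H →L[ℂ] H)‖ ≤ 1) : ‖ρ x‖ₑ ≤ saNorm ρ :=
  le_iSup_of_le x (le_iSup_of_le hx (le_iSup_of_le hx' le_rfl))

theorem saNorm_le_iff {ρ : M →ₗ[ℂ] ℂ} {r : ℝ≥0∞} : saNorm ρ ≤ r ↔
    ∀ x : M, IsSelfAdjoint (x : H →L[ℂ] H) → ‖(x : H →L[ℂ] H)‖ ≤ 1 → ‖ρ x‖ₑ ≤ r := by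
  simp only [saNorm, iSup_le_iff]

/-- Bounded sequences of self-adjoint elements produce, by backward iteration and a limit along an
ultrafilter, inverse sequences. -/
theorem exists_isInverseSequence_tendsto {z : ℕ → M}
    (hz : ∀ k, IsSelfAdjoint (z k : H →L[ℂ] H) ∧ ‖(z k : H →L[ℂ] H)‖ ≤ 1) :
    ∃ x : ℤ → M, IsInverseSequence φ x ∧
      (∀ n, IsSelfAdjoint (x n : H →L[ℂ] H) ∧ ‖(x n : H →L[ℂ] H)‖ ≤ 1) ∧
      Tendsto (fun k => φ.iterate k (z k)) (hyperfilter ℕ) (@nhds _ M.weakStar (x 0)) := by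
  -- The truncation by `toNat` matters only for `k < n`, finitely many `k` that the ultrafilter
  -- ignores.
  let y : ℤ → ℕ → M := fun n k => φ.iterate (k - n).toNat (z k)
  have hy : ∀ n k, IsSelfAdjoint (y n k : H →L[ℂ] H) ∧ ‖(y n k : H →L[ℂ] H)‖ ≤ 1 := fun n k => by
    obtain ⟨h1, h2⟩ := (φ.iterate (k - n).toNat).isSelfAdjoint_and_norm_le (hz k).1
    exact ⟨h1, h2.trans (hz k).2⟩
  choose x hx hxlim using fun n => exists_tendsto_weakStar_selfAdjoint (hyperfilter ℕ) (hy n)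
  refine ⟨x, ⟨⟨1, fun n => (hx n).2⟩, fun n => ?_⟩, hx, ?_⟩
  · refine tendsto_weakStar_unique (hxlim n) ((φ.tendsto (hxlim (n + 1))).congr' ?_)
    refine Nat.hyperfilter_le_atTop ((eventually_ge_atTop (n + 1).toNat).mono fun k hk => ?_)
    have h : ((k : ℤ) - n).toNat = ((k : ℤ) - (n + 1)).toNat + 1 := by omega
    simp only [y, h, UPMap.iterate_succ]
  · simpa [y] using hxlim 0

/-- The norms decrease because `φ` contracts self-adjoint elements, so the limit is the infimum.
That infimum is attained through limits of nearly norming elements, and `x₀ = φᵏ(xₖ)` gives the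
other inequality. -/
theorem tendsto_saNorm_inverseEval {ρ : M →ₗ[ℂ] ℂ} (hρ : IsNormalFunctional ρ) :
    Tendsto (fun k : ℕ => saNorm (ρ ∘ₗ (φ.toLinearMap ^ k))) atTop
      (𝓝 (saNorm (ρ ∘ₗ (inverseEval φ).toLinearMap))) := by
  have hanti : Antitone fun k : ℕ => saNorm (ρ ∘ₗ (φ.toLinearMap ^ k)) :=
    antitone_nat_of_succ_le fun k => saNorm_le_iff.2 fun x hx hx' => by
      obtain ⟨h1, h2⟩ := φ.isSelfAdjoint_and_norm_le hx
      rw [pow_succ]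
      exact enorm_le_saNorm (ρ := ρ ∘ₗ (φ.toLinearMap ^ k)) h1 (h2.trans hx')
  have heq : ⨅ k : ℕ, saNorm (ρ ∘ₗ (φ.toLinearMap ^ k)) =
      saNorm (ρ ∘ₗ (inverseEval φ).toLinearMap) := by
    refine le_antisymm (le_of_forall_lt_imp_le_of_dense fun r hr => ?_)
      (le_iInf fun k => saNorm_le_iff.2 fun T hT hT' => ?_)
    · have hz : ∀ k : ℕ, ∃ z : M, (IsSelfAdjoint (z : H →L[ℂ] H) ∧ ‖(z : H →L[ℂ] H)‖ ≤ 1) ∧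
          r < ‖ρ (φ.iterate k z)‖ₑ := fun k => by
        have := hr.trans_le (iInf_le _ k)
        simp only [saNorm, lt_iSup_iff] at this
        obtain ⟨z, h1, h2, h3⟩ := this
        exact ⟨z, ⟨h1, h2⟩, h3⟩
      choose z hz hzr using hz
      obtain ⟨x, hx, hx1, hlim⟩ := exists_isInverseSequence_tendsto φ hz
      have hd := IsDiagonalOf.isDiagonalOf_lpDiagonal x 1 fun n => (hx1 n).2
      set T : inverseSystem φ := ⟨_, x, hx, hd⟩ with hT
      have hT0 : inverseEval φ T = x 0 := congrFun ((isDiagonalOf_inverseSeq T).seq_eq hd) 0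
      refine le_trans ?_ (enorm_le_saNorm (x := T) (hd.isSelfAdjoint fun n => (hx1 n).1)
        (norm_lpDiagonal_le _ _ (fun n => (hx1 n).2) zero_le_one))
      rw [LinearMap.comp_apply, hT0]
      exact ge_of_tendsto (hρ.tendsto hlim).enorm (univ_mem' fun k => (hzr k).le)
    · have h1 : (ρ ∘ₗ (inverseEval φ).toLinearMap) T =
          (ρ ∘ₗ (φ.toLinearMap ^ k)) (inverseSeq T k) := by
        have := (isInverseSequence_inverseSeq T).eq_iterate k 0
        rw [zero_add] at this
        exact congrArg ρ this
      rw [h1]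
      refine enorm_le_saNorm ?_ ?_
      · rw [coe_inverseSeq]
        exact lpEntry_isSelfAdjoint hT
      · rw [coe_inverseSeq]
        exact (norm_lpEntry_le _ _).trans hT'
  rw [← heq]
  exact tendsto_atTop_iInf hanti

theorem isAsymptoticLift_inverseAut : IsAsymptoticLift φ (inverseAut φ) (inverseEval φ) :=
  ⟨isReversibleLift_inverseAut φ, isNondegenerateLift_inverseAut φ,
    fun _ hρ => tendsto_saNorm_inverseEval φ hρ⟩

end InverseSystem

theorem norm_vectorSeriesFunctional_le {H : Type*} [NormedAddCommGroup H] [InnerProductSpace ℂ H]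
    (ξ η : lp (fun _ : ℕ => H) 2) (T : H →L[ℂ] H) :
    ‖vectorSeriesFunctional ξ η T‖ ≤ (‖ξ‖ ^ 2 + ‖η‖ ^ 2) * ‖T‖ := by
  have hs := (lp_two_summable_sq ξ).add (lp_two_summable_sq η)
  refine (norm_tsum_le_tsum_norm (summable_vectorSeriesFunctional ξ η T)).trans ?_
  rw [lp_two_norm_sq, lp_two_norm_sq, ← (lp_two_summable_sq ξ).tsum_add (lp_two_summable_sq η),
    ← tsum_mul_right]
  refine (summable_vectorSeriesFunctional ξ η T).tsum_le_tsum (fun n => ?_) (hs.mul_right _)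
  calc ‖(inner ℂ (ξ n) (T (η n)) : ℂ)‖ ≤ ‖ξ n‖ * (‖T‖ * ‖η n‖) :=
        (norm_inner_le_norm _ _).trans (by gcongr; exact T.le_opNorm _)
    _ = (‖ξ n‖ * ‖η n‖) * ‖T‖ := by ring
    _ ≤ _ := by
        gcongr
        nlinarith [sq_nonneg (‖ξ n‖ - ‖η n‖), sq_nonneg (‖ξ n‖), sq_nonneg (‖η n‖)]

/-! ### Comparison of asymptotic lifts -/

section Lifts

variable {H : Type*} [NormedAddCommGroup H] [InnerProductSpace ℂ H] [CompleteSpace H]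
  {M : DualOperatorSystem H} {φ : UPMap M M}

namespace DualOperatorSystem

theorem IsNormalFunctional.add {ρ σ : M →ₗ[ℂ] ℂ} (hρ : IsNormalFunctional ρ)
    (hσ : IsNormalFunctional σ) : IsNormalFunctional (ρ + σ) :=
  isNormalFunctional_iff.2 fun z =>
    (isNormalFunctional_iff.1 hρ z).add (isNormalFunctional_iff.1 hσ z)

theorem IsNormalFunctional.smul {ρ : M →ₗ[ℂ] ℂ} (hρ : IsNormalFunctional ρ) (c : ℂ) :
    IsNormalFunctional (c • ρ) :=
  isNormalFunctional_iff.2 fun z => (isNormalFunctional_iff.1 hρ z).const_mul c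

end DualOperatorSystem

variable {K₁ : Type*} [NormedAddCommGroup K₁] [InnerProductSpace ℂ K₁] [CompleteSpace K₁]
  {K₂ : Type*} [NormedAddCommGroup K₂] [InnerProductSpace ℂ K₂] [CompleteSpace K₂]
  {N₁ : DualOperatorSystem K₁} {α₁ : UPIso N₁ N₁} {E₁ : UPMap N₁ M}
  {N₂ : DualOperatorSystem K₂} {α₂ : UPIso N₂ N₂} {E₂ : UPMap N₂ M}

/-- If `E₁` and `E₂` induce the same norms on the predual of `M`, the image under `E₁` of the
self-adjoint unit ball is contained in the corresponding image under `E₂`. -/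
theorem exists_eq_of_saNorm_le
    (h : ∀ ρ : M →ₗ[ℂ] ℂ, IsNormalFunctional ρ →
      saNorm (ρ ∘ₗ E₁.toLinearMap) ≤ saNorm (ρ ∘ₗ E₂.toLinearMap))
    {y : N₁} (hy : IsSelfAdjoint (y : K₁ →L[ℂ] K₁)) (hy' : ‖(y : K₁ →L[ℂ] K₁)‖ ≤ 1) :
    ∃ z : N₂, (IsSelfAdjoint (z : K₂ →L[ℂ] K₂) ∧ ‖(z : K₂ →L[ℂ] K₂)‖ ≤ 1) ∧ E₂ z = E₁ y := by
  let X := {z : N₂ // IsSelfAdjoint (z : K₂ →L[ℂ] K₂) ∧ ‖(z : K₂ →L[ℂ] K₂)‖ ≤ 1}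
  let _ : TopologicalSpace X := TopologicalSpace.induced Subtype.val N₂.weakStar
  have hnhds : ∀ (F : Filter X) (z : X), F ≤ 𝓝 z ↔
      Tendsto Subtype.val F (@nhds _ N₂.weakStar z.1) := fun F z => by
    rw [@nhds_induced _ _ N₂.weakStar, ← tendsto_iff_comap]
  have : CompactSpace X := ⟨isCompact_iff_ultrafilter_le_nhds.2 fun F _ => by
    obtain ⟨z, hz, h⟩ := exists_tendsto_weakStar_selfAdjoint F (x := Subtype.val)
      fun x : X => x.2
    exact ⟨⟨z, hz⟩, Set.mem_univ _, (hnhds _ _).2 h⟩⟩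
  have : Nonempty X := ⟨⟨0, by simp [IsSelfAdjoint.zero]⟩⟩
  have hcont : ∀ {ρ : M →ₗ[ℂ] ℂ}, IsNormalFunctional ρ → Continuous fun z : X => (ρ (E₂ z.1)).re :=
    fun {ρ} hρ => continuous_iff_continuousAt.2 fun z => (Complex.continuous_re.tendsto _).comp
      (hρ.tendsto (E₂.tendsto ((hnhds _ _).1 le_rfl)))
  -- The admissible `ρ` form a real vector space, so a point where all members are nonnegative
  -- serves `ρ` and `-ρ` at once and gives equality.
  let S : Set (X → ℝ) := {s | ∃ ρ : M →ₗ[ℂ] ℂ, IsNormalFunctional ρ ∧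
    (∀ x : M, IsSelfAdjoint (x : H →L[ℂ] H) → (ρ x).im = 0) ∧
    s = fun z => (ρ (E₂ z.1)).re - (ρ (E₁ y)).re}
  have hS : Convex ℝ S := by
    rintro _ ⟨ρ, hρ, hρ', rfl⟩ _ ⟨σ, hσ, hσ', rfl⟩ a b - - -
    refine ⟨(a : ℂ) • ρ + (b : ℂ) • σ, (hρ.smul _).add (hσ.smul _), fun x hx => ?_,
      funext fun z => ?_⟩
    · simp [hρ' x hx, hσ' x hx]
    · simp only [Pi.add_apply, Pi.smul_apply, smul_eq_mul, LinearMap.add_apply,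
        LinearMap.smul_apply, Complex.add_re, Complex.re_ofReal_mul]
      ring
  obtain ⟨z, hz⟩ := exists_forall_nonneg_of_convex hS
    (by
      rintro _ ⟨ρ, hρ, -, rfl⟩
      exact (hcont hρ).sub continuous_const)
    (by
      intro u v a b ha hb hab
      refine ⟨⟨(a : ℂ) • u.1 + (b : ℂ) • v.1, ?_, ?_⟩, ?_⟩
      · have hreal : ∀ c : ℝ, IsSelfAdjoint (c : ℂ) := fun c => Complex.conj_ofReal c
        exact ((hreal a).smul u.2.1).add ((hreal b).smul v.2.1)
      · calc ‖(a : ℂ) • (u.1 : K₂ →L[ℂ] K₂) + (b : ℂ) • (v.1 : K₂ →L[ℂ] K₂)‖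
            ≤ a * ‖(u.1 : K₂ →L[ℂ] K₂)‖ + b * ‖(v.1 : K₂ →L[ℂ] K₂)‖ := by
              refine (norm_add_le _ _).trans_eq ?_
              rw [norm_smul, norm_smul, Complex.norm_of_nonneg ha, Complex.norm_of_nonneg hb]
          _ ≤ a * 1 + b * 1 := by
              have := u.2.2
              have := v.2.2
              gcongr
          _ = 1 := by linarith
      · rintro _ ⟨ρ, -, -, rfl⟩
        simp only [map_add, map_smul, smul_eq_mul, Complex.add_re, Complex.re_ofReal_mul]
        obtain rfl : b = 1 - a := by linarith
        ring)
    (by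
      rintro _ ⟨ρ, hρ, hρ', rfl⟩
      by_contra hneg
      push Not at hneg
      obtain ⟨z₀, -, hz₀⟩ := isCompact_univ.exists_isMaxOn Set.univ_nonempty
        (hcont hρ).continuousOn
      -- The ball is symmetric and `ρ` is real on self-adjoint elements, so the maximum of `Re ρ ∘
      -- E₂` bounds `saNorm (ρ ∘ E₂)`.
      set m := (ρ (E₂ z₀.1)).re with hm
      have hle : saNorm (ρ ∘ₗ E₂.toLinearMap) ≤ ENNReal.ofReal m :=
        saNorm_le_iff.2 fun z hz hz' => by
          have h1 : (ρ (E₂ z)).re ≤ m := hz₀ (Set.mem_univ ⟨z, hz, hz'⟩)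
          have h2 : (ρ (E₂ (-z))).re ≤ m :=
            hz₀ (Set.mem_univ ⟨-z, hz.neg, (norm_neg (z : K₂ →L[ℂ] K₂)).trans_le hz'⟩)
          rw [map_neg, map_neg, Complex.neg_re] at h2
          rw [LinearMap.comp_apply, ← ofReal_norm]
          refine ENNReal.ofReal_le_ofReal ?_
          rw [← Complex.abs_re_eq_norm.2 (hρ' _ (E₂.isSelfAdjoint hz))]
          exact abs_le.2 ⟨by linarith, h1⟩
      have h3 := hneg z₀
      have h4 : m < ‖ρ (E₁ y)‖ := by
        have := Complex.re_le_norm (ρ (E₁ y))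
        linarith
      have h5 : ENNReal.ofReal m < ‖ρ (E₁ y)‖ₑ := by
        rw [← ofReal_norm]
        exact (ENNReal.ofReal_lt_ofReal_iff_of_nonneg (by
          by_contra hm0
          have h6 : (ρ (E₂ (-z₀.1))).re ≤ m := hz₀ (Set.mem_univ
            ⟨-z₀.1, z₀.2.1.neg, (norm_neg (z₀.1 : K₂ →L[ℂ] K₂)).trans_le z₀.2.2⟩)
          rw [map_neg, map_neg, Complex.neg_re] at h6
          linarith)).2 h4
      exact absurd ((enorm_le_saNorm (ρ := ρ ∘ₗ E₁.toLinearMap) hy hy').trans ((h ρ hρ).trans hle))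
        (not_le.2 h5))
  refine ⟨z.1, z.2, sub_eq_zero.1 ?_⟩
  set d := E₂ z.1 - E₁ y with hd
  have hdsa : IsSelfAdjoint (d : H →L[ℂ] H) := (E₂.isSelfAdjoint z.2.1).sub (E₁.isSelfAdjoint hy)
  have hsymm := ContinuousLinearMap.isSelfAdjoint_iff_isSymmetric.1 hdsa
  -- A self-adjoint operator with vanishing quadratic form is zero, so functionals `⟨v, · v⟩`
  -- suffice as tests.
  refine Subtype.ext (ContinuousLinearMap.coe_injective
    ((hsymm.inner_map_self_eq_zero).1 fun v => ?_))
  let ρ : M →ₗ[ℂ] ℂ :=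
    vectorSeriesLinear (lp.single 2 0 v) (lp.single 2 0 v) ∘ₗ M.toSubmodule.subtype
  have hρ : IsNormalFunctional ρ := isNormalFunctional_vectorSeries _ _
  have hρv : ∀ x : M, ρ x = inner ℂ v ((x : H →L[ℂ] H) v) := fun x =>
    vectorSeriesFunctional_single v v x
  have hρ' : ∀ x : M, IsSelfAdjoint (x : H →L[ℂ] H) → (ρ x).im = 0 := fun x hx => by
    rw [hρv]
    exact (ContinuousLinearMap.isSelfAdjoint_iff_isSymmetric.1 hx).im_inner_self_apply v
  have h1 := hz _ ⟨ρ, hρ, hρ', rfl⟩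
  have h2 := hz _ ⟨(-1 : ℂ) • ρ, hρ.smul _, fun x hx => by simp [hρ' x hx], rfl⟩
  have h3 : (ρ d).re = 0 := by
    simp only [LinearMap.smul_apply, smul_eq_mul, neg_mul, one_mul, Complex.neg_re] at h2
    rw [hd, map_sub, Complex.sub_re]
    linarith
  have h4 : ρ d = 0 := Complex.ext h3 (hρ' d hdsa)
  rw [hρv] at h4
  exact inner_eq_zero_symm.1 h4

/-- Lets linearity, normality and contractivity of UP maps be used for iterates of `α⁻¹`. -/
theorem UPIso.iterate_invUPMap (α : UPIso N₁ N₁) (n : ℕ) (y : N₁) :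
    α.invUPMap.iterate n y = α.toLinearEquiv.symm^[n] y :=
  Module.End.pow_apply _ _ _

/-- The code `n ↦ E(α⁻ⁿ y)` obeys the recursion of an inverse sequence, so a later entry determines
all earlier ones. -/
theorem IsReversibleLift.iterate_apply (h : IsReversibleLift φ α₁ E₁) (j n : ℕ) (y : N₁) :
    φ.iterate j (E₁ (α₁.toLinearEquiv.symm^[n + j] y)) = E₁ (α₁.toLinearEquiv.symm^[n] y) := by
  induction j with
  | zero => rfl
  | succ j ih =>
    rw [UPMap.iterate_succ', ← add_assoc, Function.iterate_succ_apply', ← h,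
      LinearEquiv.apply_symm_apply, ih]

theorem IsAsymptoticLift.exists_selfAdjoint_of_norm_le_one (h₁ : IsAsymptoticLift φ α₁ E₁)
    (h₂ : IsAsymptoticLift φ α₂ E₂) {y : N₁} (hy : IsSelfAdjoint (y : K₁ →L[ℂ] K₁))
    (hy' : ‖(y : K₁ →L[ℂ] K₁)‖ ≤ 1) :
    ∃ z : N₂, (IsSelfAdjoint (z : K₂ →L[ℂ] K₂) ∧ ‖(z : K₂ →L[ℂ] K₂)‖ ≤ 1) ∧
      ∀ n : ℕ, E₂ (α₂.toLinearEquiv.symm^[n] z) = E₁ (α₁.toLinearEquiv.symm^[n] y) := by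
  have hz : ∀ k : ℕ, ∃ z : N₂, (IsSelfAdjoint (z : K₂ →L[ℂ] K₂) ∧ ‖(z : K₂ →L[ℂ] K₂)‖ ≤ 1) ∧
      E₂ z = E₁ (α₁.toLinearEquiv.symm^[k] y) := fun k => by
    rw [← UPIso.iterate_invUPMap]
    obtain ⟨h3, h4⟩ := (α₁.invUPMap.iterate k).isSelfAdjoint_and_norm_le hy
    exact exists_eq_of_saNorm_le (fun ρ hρ => (tendsto_nhds_unique (h₁.tendsto_saNorm ρ hρ)
      (h₂.tendsto_saNorm ρ hρ)).le) h3 (h4.trans hy')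
  choose z hz hzE using hz
  -- The code of `w k` agrees with that of `y` at index `k`, hence at all indices up to `k`; a limit
  -- point agrees everywhere.
  let w : ℕ → N₂ := fun k => α₂.toUPMap.iterate k (z k)
  have hw : ∀ k, IsSelfAdjoint (w k : K₂ →L[ℂ] K₂) ∧ ‖(w k : K₂ →L[ℂ] K₂)‖ ≤ 1 := fun k => by
    obtain ⟨h3, h4⟩ := (α₂.toUPMap.iterate k).isSelfAdjoint_and_norm_le (hz k).1
    exact ⟨h3, h4.trans (hz k).2⟩
  have hwz : ∀ k, α₂.toLinearEquiv.symm^[k] (w k) = z k := fun k => by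
    have h3 : w k = α₂.toLinearEquiv^[k] (z k) := Module.End.pow_apply _ _ _
    rw [h3]
    exact Function.LeftInverse.iterate α₂.toLinearEquiv.symm_apply_apply k (z k)
  obtain ⟨w₀, hw₀, hlim⟩ := exists_tendsto_weakStar_selfAdjoint (hyperfilter ℕ) hw
  refine ⟨w₀, hw₀, fun n => ?_⟩
  rw [← UPIso.iterate_invUPMap]
  refine tendsto_weakStar_unique (E₂.tendsto ((α₂.invUPMap.iterate n).tendsto hlim))
    ((@tendsto_const_nhds _ M.weakStar _ _ _).congr'
      (Nat.hyperfilter_le_atTop ((eventually_ge_atTop n).mono fun k hk => ?_)))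
  obtain ⟨j, rfl⟩ := Nat.exists_eq_add_of_le hk
  dsimp only
  rw [UPIso.iterate_invUPMap, ← h₂.reversible.iterate_apply j n, hwz, hzE,
    h₁.reversible.iterate_apply]

theorem IsAsymptoticLift.exists_selfAdjoint (h₁ : IsAsymptoticLift φ α₁ E₁)
    (h₂ : IsAsymptoticLift φ α₂ E₂) {y : N₁} (hy : IsSelfAdjoint (y : K₁ →L[ℂ] K₁)) :
    ∃ z : N₂, (IsSelfAdjoint (z : K₂ →L[ℂ] K₂) ∧
      ‖(z : K₂ →L[ℂ] K₂)‖ ≤ ‖(y : K₁ →L[ℂ] K₁)‖) ∧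
      ∀ n : ℕ, E₂ (α₂.toLinearEquiv.symm^[n] z) = E₁ (α₁.toLinearEquiv.symm^[n] y) := by
  rcases eq_or_ne (y : K₁ →L[ℂ] K₁) 0 with h0 | h0
  · obtain rfl : y = 0 := Subtype.ext h0
    refine ⟨0, ⟨.zero _, by simp⟩, fun n => ?_⟩
    simp only [← UPIso.iterate_invUPMap, map_zero]
  · set c := ‖(y : K₁ →L[ℂ] K₁)‖ with hc
    have hc0 : 0 < c := norm_pos_iff.2 h0
    have hreal : ∀ r : ℝ, IsSelfAdjoint (r : ℂ) := fun r => Complex.conj_ofReal r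
    obtain ⟨z, ⟨hz, hz'⟩, h⟩ := h₁.exists_selfAdjoint_of_norm_le_one h₂
      (y := ((c⁻¹ : ℝ) : ℂ) • y) ((hreal _).smul hy) (by
        rw [Submodule.coe_smul, norm_smul, Complex.norm_real, norm_inv, hc, norm_norm,
          inv_mul_cancel₀ hc0.ne'])
    refine ⟨(c : ℂ) • z, ⟨(hreal _).smul hz, ?_⟩, fun n => ?_⟩
    · rw [Submodule.coe_smul, norm_smul, Complex.norm_of_nonneg hc0.le]
      exact mul_le_of_le_one_right hc0.le hz'
    · have := h n
      simp only [← UPIso.iterate_invUPMap, map_smul] at this ⊢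
      rw [this, smul_smul, ← Complex.ofReal_mul, mul_inv_cancel₀ hc0.ne', Complex.ofReal_one,
        one_smul]

theorem IsAsymptoticLift.eq_of_forall (h₁ : IsAsymptoticLift φ α₁ E₁) {y z : N₁}
    (h : ∀ n : ℕ, E₁ (α₁.toLinearEquiv.symm^[n] y) = E₁ (α₁.toLinearEquiv.symm^[n] z)) :
    y = z := by
  refine sub_eq_zero.1 (h₁.nondegenerate _ fun n => ?_)
  have := h n
  simp only [← UPIso.iterate_invUPMap] at this ⊢
  rw [map_sub, map_sub, this, sub_self]

/-- `θ y` is the only element of `N₂` with the code of `y`, and each algebraic property follows from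
this uniqueness. For normality, a weak-star limit of `θ x` as `x → z` in the unit ball has the code
of `z`, hence is `θ z`. -/
theorem IsAsymptoticLift.exists_comparison (h₁ : IsAsymptoticLift φ α₁ E₁)
    (h₂ : IsAsymptoticLift φ α₂ E₂) :
    ∃ θ : UPMap N₁ N₂, ∀ y : N₁, ∀ n : ℕ,
      E₂ (α₂.toLinearEquiv.symm^[n] (θ y)) = E₁ (α₁.toLinearEquiv.symm^[n] y) := by
  -- The factor `2` comes from treating real and imaginary parts separately; only some uniform bound
  -- is needed.
  have hex : ∀ y : N₁, ∃ z : N₂, ‖(z : K₂ →L[ℂ] K₂)‖ ≤ 2 * ‖(y : K₁ →L[ℂ] K₁)‖ ∧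
      ∀ n : ℕ, E₂ (α₂.toLinearEquiv.symm^[n] z) = E₁ (α₁.toLinearEquiv.symm^[n] y) := by
    intro y
    obtain ⟨a, b, ⟨ha, ha'⟩, ⟨hb, hb'⟩, hy⟩ := exists_selfAdjoint_decomposition y
    obtain ⟨u, ⟨-, hu⟩, hau⟩ := h₁.exists_selfAdjoint h₂ ha
    obtain ⟨v, ⟨-, hv⟩, hbv⟩ := h₁.exists_selfAdjoint h₂ hb
    refine ⟨u + Complex.I • v, ?_, fun n => ?_⟩
    · refine (norm_add_le (u : K₂ →L[ℂ] K₂) (Complex.I • (v : K₂ →L[ℂ] K₂))).trans ?_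
      rw [norm_smul, Complex.norm_I, one_mul]
      linarith
    · have h3 := hau n
      have h4 := hbv n
      simp only [← UPIso.iterate_invUPMap] at h3 h4 ⊢
      conv_rhs => rw [hy]
      simp only [map_add, map_smul, h3, h4]
  choose θ hθn hθ using hex
  have huniq : ∀ {y : N₁} {z : N₂},
      (∀ n : ℕ, E₂ (α₂.toLinearEquiv.symm^[n] z) = E₁ (α₁.toLinearEquiv.symm^[n] y)) →
      z = θ y := fun {y z} h => h₂.eq_of_forall fun n => (h n).trans (hθ y n).symm
  let Θ : N₁ →ₗ[ℂ] N₂ :=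
    { toFun := θ
      map_add' := fun x y => (huniq fun n => by
        have h3 := hθ x n
        have h4 := hθ y n
        simp only [← UPIso.iterate_invUPMap] at h3 h4 ⊢
        simp only [map_add, h3, h4]).symm
      map_smul' := fun c x => (huniq fun n => by
        have h3 := hθ x n
        simp only [← UPIso.iterate_invUPMap] at h3 ⊢
        simp only [map_smul, h3, RingHom.id_apply]).symm }
  have hunit : Θ N₁.unit = N₂.unit := (huniq fun n => by
    simp only [← UPIso.iterate_invUPMap, UPMap.map_unit]).symm
  have hsa : ∀ x : N₁, IsSelfAdjoint (x : K₁ →L[ℂ] K₁) →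
      IsSelfAdjoint (Θ x : K₂ →L[ℂ] K₂) ∧ ‖(Θ x : K₂ →L[ℂ] K₂)‖ ≤ ‖(x : K₁ →L[ℂ] K₁)‖ := by
    intro x hx
    obtain ⟨z, hz, h⟩ := h₁.exists_selfAdjoint h₂ hx
    rwa [show Θ x = z from (huniq h).symm]
  have hnormal : ∀ ξ η : lp (fun _ : ℕ => K₂) 2,
      IsNormalFunctional ((vectorSeriesLinear ξ η ∘ₗ N₂.toSubmodule.subtype) ∘ₗ Θ) := by
    intro ξ η
    refine IsBallContinuous.isNormalFunctional (C := (‖ξ‖ ^ 2 + ‖η‖ ^ 2) * 2)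
      (fun F z hF hz => ?_) fun x => ?_
    · classical
      -- Compactness asks for a bound at every index, so `θ` is replaced by `0` off the unit ball,
      -- which `F` does not see.
      obtain ⟨w, -, hw⟩ := exists_tendsto_weakStar F (M := N₂) (C := 2)
        (x := fun x => if ‖(x : K₁ →L[ℂ] K₁)‖ ≤ 1 then θ x else 0) (fun x => by
          split_ifs with hx
          · exact (hθn x).trans (by linarith)
          · simp)
      have hw' : Tendsto θ F (@nhds _ N₂.weakStar w) :=
        hw.congr' (hF.mono fun x hx => if_pos hx)
      have : w = θ z := huniq fun n => by
        refine tendsto_weakStar_unique (l := F) (x := fun x => E₁ (α₁.toLinearEquiv.symm^[n] x))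
          ?_ ?_
        · refine Tendsto.congr (fun x => hθ x n) ?_
          simp only [← UPIso.iterate_invUPMap]
          exact E₂.tendsto ((α₂.invUPMap.iterate n).tendsto hw')
        · simp only [← UPIso.iterate_invUPMap]
          exact E₁.tendsto ((α₁.invUPMap.iterate n).tendsto (tendsto_id'.2 hz))
      rw [this] at hw'
      exact (isNormalFunctional_vectorSeries ξ η).tendsto hw'
    · refine (norm_vectorSeriesFunctional_le ξ η _).trans ?_
      rw [mul_assoc]
      gcongr
      exact hθn x
  exact ⟨⟨Θ, hunit, UPMap.nonneg_of_contractive hunit hsa, UPMap.continuous_of_tendsto fun z =>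
    tendsto_ultraweak_iff.2 fun ξ η => isNormalFunctional_iff.1 (hnormal ξ η) z⟩, hθ⟩

/-- The comparison maps in the two directions preserve codes, so both composites are identities. Any
`σ` that intertwines the automorphisms and evaluations also preserves codes, hence equals `θ`. -/
theorem IsAsymptoticLift.existsUnique_iso (h₁ : IsAsymptoticLift φ α₁ E₁)
    (h₂ : IsAsymptoticLift φ α₂ E₂) :
    ∃! θ : UPIso N₁ N₂, (∀ y : N₁, θ (α₁ y) = α₂ (θ y)) ∧ ∀ y : N₁, E₂ (θ y) = E₁ y := by
  obtain ⟨θ, hθ⟩ := h₁.exists_comparison h₂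
  obtain ⟨θ', hθ'⟩ := h₂.exists_comparison h₁
  refine ⟨UPIso.ofInverse θ θ' (fun y => h₁.eq_of_forall fun n => by rw [hθ', hθ])
    (fun z => h₂.eq_of_forall fun n => by rw [hθ, hθ']), ⟨fun y => ?_, fun y => hθ y 0⟩,
    fun σ hσ => UPIso.ext' fun y => h₂.eq_of_forall fun n => ?_⟩
  · refine h₂.eq_of_forall fun n => (hθ (α₁ y) n).trans ?_
    -- Entry `0` of the code of `α y` is `φ` of entry `0` of the code of `y`; the later entries are
    -- the code of `y` shifted by one.
    cases n with
    | zero =>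
      refine (h₁.reversible y).trans ((congrArg φ (hθ y 0).symm).trans ?_)
      exact (h₂.reversible (θ y)).symm
    | succ n =>
      rw [Function.iterate_succ_apply, Function.iterate_succ_apply,
        LinearEquiv.symm_apply_apply, LinearEquiv.symm_apply_apply]
      exact (hθ y n).symm
  · refine Eq.trans ?_ (hθ y n).symm
    have hcomm : ∀ x, α₂.toLinearEquiv.symm (σ x) = σ (α₁.toLinearEquiv.symm x) := fun x => by
      rw [LinearEquiv.symm_apply_eq, ← hσ.1, LinearEquiv.apply_symm_apply]
    rw [← hσ.2]
    congr 1
    clear hσ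
    induction n with
    | zero => rfl
    | succ n ih =>
      rw [Function.iterate_succ_apply', Function.iterate_succ_apply', ih, hcomm]

end Lifts

/-! ### The theorem -/

theorem theorem2p4 {H : Type*} [NormedAddCommGroup H] [InnerProductSpace ℂ H]
    [CompleteSpace H] (M : DualOperatorSystem H) (φ : UPMap M M) :
    -- existence, realized on the space of inverse sequences with the bilateral shift
    (∃ (N : DualOperatorSystem (lp (fun _ : ℤ => H) 2)) (α : UPIso N N) (E : UPMap N M),
      IsAsymptoticLift φ α E ∧
      (∀ T : lp (fun _ : ℤ => H) 2 →L[ℂ] lp (fun _ : ℤ => H) 2,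
        T ∈ N.toSubmodule ↔ ∃ x : ℤ → M, IsInverseSequence φ x ∧ IsDiagonalOf T x) ∧
      (∀ (T : N) (x : ℤ → M), IsDiagonalOf T.1 x →
        IsDiagonalOf (α T).1 (fun n => x (n - 1)) ∧ E T = x 0)) ∧
    -- uniqueness up to a unique isomorphism
    (∀ (K₁ : Type*) [NormedAddCommGroup K₁] [InnerProductSpace ℂ K₁] [CompleteSpace K₁]
      (K₂ : Type*) [NormedAddCommGroup K₂] [InnerProductSpace ℂ K₂] [CompleteSpace K₂]
      (N₁ : DualOperatorSystem K₁) (α₁ : UPIso N₁ N₁) (E₁ : UPMap N₁ M)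
      (N₂ : DualOperatorSystem K₂) (α₂ : UPIso N₂ N₂) (E₂ : UPMap N₂ M),
      IsAsymptoticLift φ α₁ E₁ → IsAsymptoticLift φ α₂ E₂ →
      ∃! θ : UPIso N₁ N₂, (∀ y : N₁, θ (α₁ y) = α₂ (θ y)) ∧ ∀ y : N₁, E₂ (θ y) = E₁ y) := by
  refine ⟨⟨inverseSystem φ, inverseAut φ, inverseEval φ, isAsymptoticLift_inverseAut φ,
    fun T => mem_inverseSystem φ, fun T x hx => ⟨?_, ?_⟩⟩, ?_⟩
  · exact inverseShift_isDiagonalOf φ hx (-1)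
  · exact congrFun ((isDiagonalOf_inverseSeq T).seq_eq hx) 0
  · intro K₁ _ _ _ K₂ _ _ _ N₁ α₁ E₁ N₂ α₂ E₂ h₁ h₂
    exact h₁.existsUnique_iso h₂
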